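/- Let $d\ge 1$, $\varepsilon>0$ and $\kappa\ge 2$. For $X>0$ put $\Omega=(0,X)^d$, and let $C^4_{per}(\overline\Omega)$ be the space of $\Omega$-periodic functions of class $C^4$ on $\mathbb R^d$ with the norm $\|u\|_{C^4}=\max_{0\le m\le 4}\sup_x\|D^mu(x)\|$. Consider the local Allen–Cahn equation $$\varphi_t-\varepsilon^2\Delta\varphi+\varphi^3-\varphi=0\ \text{ in }\Omega\times(0,T),\qquad \varphi(\cdot,t)\ \Omega\text{-periodic},\qquad \varphi(\cdot,0)=\varphi_0 .\tag{LAC}$$ *Discretization.* For $\delta>0$, an admissible kernel is a function $\rho_\delta\ge0$ on $[0,\delta]$ with $\int_{B_\delta(0)}|s|^2\rho_\delta(|s|)\,ds=2d$. Let $N\ge1$, $h=X/N$, $s_j=hj$ for $j\in\mathbb Z^d$, let $\psi_j$ be the piecewise $d$-multilinear nodal basis functions of this mesh, and let $I^h$ denote restriction to the mesh $h\mathbb Z^d$. On periodic grid functions set $$(\mathcal L_{\delta,h}U)(x_i)=\sum_{j\ne0}\frac{U(x_i+s_j)+U(x_i-s_j)-2U(x_i)}{|s_j|^2}\,\|s_j\|_1\,\beta_\delta(s_j),\qquad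 \beta_\delta(s_j)=\frac12\int_{B_\delta(0)}\psi_j(s)\frac{|s|^2}{\|s\|_1}\rho_\delta(|s|)\,ds,$$ a finite sum, since $\beta_\delta(s_j)=0$ unless $\operatorname{supp}\psi_j$ meets $B_\delta(0)$. Let $D_h$ be the matrix of $\mathcal L_{\delta,h}$, $L_h=-\varepsilon^2D_h+\kappa I$, and $f(U)=(\kappa+1)U-U^3$ componentwise. Let $K_t\ge1$, $\tau=T/K_t$, $t_n=n\tau$. Starting from $U^0=I^h\varphi_0$, for $0\le n<K_t$ the ETD1 scheme is $$U^{n+1}=e^{-L_h\tau}U^n+\int_0^\tau e^{-L_h(\tau-s)}f(U^n)\,ds,$$ and the ETDRK2 scheme is $$U^{n+1}=e^{-L_h\tau}U^n+\int_0^\tau e^{-L_h(\tau-s)}\Big[\Big(1-\frac s\tau\Big)f(U^n)+\frac s\tau f(\widetilde U^{n+1})\Big]ds,$$ where $\widetilde U^{n+1}$ is obtained from $U^n$ by one ETD1 step. **Theorem (asymptotic compatibility).** 1. (ETD1) For every $M$ there is a constant $C>0$, depending only on $d,\varepsilon,\kappa,M$, such that for all $X,T>0$ and every solution $\varphi\in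 C^1([0,T];C^4_{per}(\overline\Omega))$ of (LAC) with $C^1([0,T];C^4_{per}(\overline\Omega))$ norm at most $M$ and $\|\varphi_0\|_{L^\infty}\le1$, the ETD1 iterates satisfy $$\|U^n-I^h\varphi(t_n)\|_\infty\le Ce^{t_n}(\delta^2+h^2+\tau),\qquad 0\le n\le K_t,$$ for all $\delta>0$, all admissible $\rho_\delta$, and all $h=X/N$ and $\tau=T/K_t$. 2. (ETDRK2) For every $M$ there is a constant $C>0$, depending only on $d,\varepsilon,\kappa,M$, such that for all $X,T>0$ and every solution $\varphi\in C^2([0,T];C^4_{per}(\overline\Omega))$ of (LAC) with $C^2([0,T];C^4_{per}(\overline\Omega))$ norm at most $M$ and $\|\varphi_0\|_{L^\infty}\le1$, the ETDRK2 iterates satisfy $$\|U^n-I^h\varphi(t_n)\|_\infty\le Ce^{t_n}(\delta^2+h^2+\tau^2),\qquad 0\le n\le K_t,$$ for all $\delta>0$, all admissible $\rho_\delta$, and all $h=X/N$ and $\tau=T/K_t$ with $\tau\le1$. 3. Hence both schemes converge to the local solution: if $\varphi$ solves (LAC), $\|\varphi_0\|_{L^\infty}\le1$ and $\varphi\in C^1([0,T];C^4_{per}(\overline\Omega))$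 (resp. $C^2([0,T];C^4_{per}(\overline\Omega))$), then $\max_{0\le n\le K_t}\|U^n-I^h\varphi(t_n)\|_\infty\to0$ for ETD1 (resp. ETDRK2) as $\delta,h,\tau\to0$ jointly, uniformly over the admissible kernels. -/

import Mathlib

open Set MeasureTheory
open scoped Matrix

namespace NonlocalAC

/-- The Euclidean space `ℝ^d`. -/
abbrev Space (d : ℕ) : Type := EuclideanSpace ℝ (Fin d)

/-! ### The space `C⁴_per` -/

/-- `u` is `X`-periodic in every coordinate direction. -/
def IsCubePeriodic (d : ℕ) (X : ℝ) {F : Type*} (u : Space d → F) : Prop :=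
  ∀ k : Fin d, Function.Periodic u (EuclideanSpace.single k X)

/-- The vector space of `(0,X)^d`-periodic `C⁴` functions on `ℝ^d`. -/
def perC4Submodule (d : ℕ) (X : ℝ) : Submodule ℝ (Space d → ℝ) where
  carrier := {u | ContDiff ℝ 4 u ∧ IsCubePeriodic d X u}
  add_mem' := fun {_ _} hu hv => ⟨hu.1.add hv.1, fun k => (hu.2 k).add (hv.2 k)⟩
  zero_mem' := ⟨contDiff_const, fun _ _ => rfl⟩
  smul_mem' := fun c _ hu => ⟨hu.1.const_smul c, fun k => (hu.2 k).smul c⟩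

/-- The space `C⁴_per` of `(0,X)^d`-periodic functions of class `C⁴`.  It is given the `C⁴` norm
(and the topology of that norm) below. -/
def PerC4 (d : ℕ) (X : ℝ) : Type := perC4Submodule d X

noncomputable instance (d : ℕ) (X : ℝ) : AddCommGroup (PerC4 d X) :=
  inferInstanceAs (AddCommGroup (perC4Submodule d X))

noncomputable instance (d : ℕ) (X : ℝ) : Module ℝ (PerC4 d X) :=
  inferInstanceAs (Module ℝ (perC4Submodule d X))

instance (d : ℕ) (X : ℝ) : CoeFun (PerC4 d X) (fun _ => Space d → ℝ) := ⟨fun u => u.1⟩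

/-- The `C⁴` norm: the maximum over `m = 0, …, 4` of `sup_x ‖D^m u(x)‖`. -/
noncomputable instance (d : ℕ) (X : ℝ) : Norm (PerC4 d X) :=
  ⟨fun u => ⨆ p : Fin 5 × Space d, ‖iteratedFDeriv ℝ p.1 (⇑u : Space d → ℝ) p.2‖⟩

theorem PerC4.norm_def {d : ℕ} {X : ℝ} (u : PerC4 d X) :
    ‖u‖ = ⨆ p : Fin 5 × Space d, ‖iteratedFDeriv ℝ p.1 (⇑u : Space d → ℝ) p.2‖ := rfl

/-- A continuous periodic function is bounded. -/
theorem IsCubePeriodic.exists_bound {d : ℕ} {X : ℝ} (hX : 0 < X) {F : Type*}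
    [NormedAddCommGroup F] {u : Space d → F} (hp : IsCubePeriodic d X u) (hc : Continuous u) :
    ∃ B, ∀ x, ‖u x‖ ≤ B := by
  have hper : ∀ (s : Finset (Fin d)) (m : Fin d → ℤ),
      Function.Periodic u (∑ k ∈ s, m k • EuclideanSpace.single k X) := by
    intro s m
    induction s using Finset.induction_on with
    | empty => intro x; simp
    | insert a s ha ih =>
      rw [Finset.sum_insert ha]
      exact ((hp a).zsmul (m a)).add_period ih
  have hK : IsCompact ((WithLp.toLp 2 : (Fin d → ℝ) → Space d) '' Icc 0 (fun _ => X)) :=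
    isCompact_Icc.image (PiLp.continuous_toLp 2 _)
  obtain ⟨B, hB⟩ := hK.exists_bound_of_continuousOn hc.continuousOn
  refine ⟨B, fun x => ?_⟩
  have h1 := (hper Finset.univ (fun k => -⌊x k / X⌋)) x
  rw [← h1]
  refine hB _ ⟨fun k => X * Int.fract (x k / X), ⟨fun k => ?_, fun k => ?_⟩, ?_⟩
  · exact mul_nonneg hX.le (Int.fract_nonneg _)
  · have := Int.fract_lt_one (x k / X)
    show X * Int.fract (x k / X) ≤ X
    nlinarith
  · ext k
    have : X * (x k / X) = x k := by field_simp
    have h2 : X * Int.fract (x k / X) = x k - X * ⌊x k / X⌋ := by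
      rw [← Int.self_sub_floor, mul_sub, this]
    simp [h2, Pi.single_apply]
    ring

theorem PerC4.bddAbove {d : ℕ} {X : ℝ} (hX : 0 < X) (u : PerC4 d X) :
    BddAbove (range fun p : Fin 5 × Space d =>
      ‖iteratedFDeriv ℝ p.1 (⇑u : Space d → ℝ) p.2‖) := by
  have h : ∀ m : Fin 5, ∃ B, ∀ x, ‖iteratedFDeriv ℝ m (⇑u : Space d → ℝ) x‖ ≤ B := by
    intro m
    refine IsCubePeriodic.exists_bound hX (fun k x => ?_)
      (u.2.1.continuous_iteratedFDeriv (by exact_mod_cast Nat.lt_succ_iff.mp m.2))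
    rw [← iteratedFDeriv_comp_add_right]
    congr 1
    exact funext (u.2.2 k)
  choose B hB using h
  refine ⟨∑ m, |B m|, ?_⟩
  rintro _ ⟨⟨m, x⟩, rfl⟩
  exact (hB m x).trans ((le_abs_self _).trans
    (Finset.single_le_sum (f := fun m => |B m|) (fun _ _ => abs_nonneg _) (Finset.mem_univ m)))

theorem PerC4.normCore {d : ℕ} {X : ℝ} (hX : 0 < X) : NormedSpace.Core ℝ (PerC4 d X) where
  norm_nonneg u := Real.iSup_nonneg fun _ => norm_nonneg _
  norm_smul c u := by
    rw [PerC4.norm_def, PerC4.norm_def, Real.mul_iSup_of_nonneg (norm_nonneg c)]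
    congr 1
    funext p
    have h : iteratedFDeriv ℝ p.1 (⇑(c • u) : Space d → ℝ) p.2
        = c • iteratedFDeriv ℝ p.1 (⇑u : Space d → ℝ) p.2 :=
      iteratedFDeriv_const_smul_apply
        ((u.2.1.of_le (by exact_mod_cast Nat.lt_succ_iff.mp p.1.2)).contDiffAt)
    rw [h, norm_smul]
  norm_triangle u v := by
    rw [PerC4.norm_def]
    refine ciSup_le fun p => ?_
    have hle : ((p.1 : ℕ) : WithTop ℕ∞) ≤ 4 := by exact_mod_cast Nat.lt_succ_iff.mp p.1.2
    have h : iteratedFDeriv ℝ p.1 (⇑(u + v) : Space d → ℝ) p.2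
        = iteratedFDeriv ℝ p.1 (⇑u : Space d → ℝ) p.2
          + iteratedFDeriv ℝ p.1 (⇑v : Space d → ℝ) p.2 :=
      iteratedFDeriv_add_apply (u.2.1.of_le hle).contDiffAt (v.2.1.of_le hle).contDiffAt
    rw [h]
    exact (norm_add_le _ _).trans
      (add_le_add (le_ciSup (PerC4.bddAbove hX u) p) (le_ciSup (PerC4.bddAbove hX v) p))
  norm_eq_zero_iff u := by
    constructor
    · intro h
      apply Subtype.ext
      funext x
      have h0 := le_ciSup (PerC4.bddAbove hX u) ((0 : Fin 5), x)
      rw [← PerC4.norm_def, h] at h0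
      have h1 : u.1 x = 0 := by simpa using h0
      exact h1
    · rintro rfl
      rw [PerC4.norm_def]
      have h : (⇑(0 : PerC4 d X) : Space d → ℝ) = 0 := rfl
      simp [h]

noncomputable instance (d : ℕ) (X : ℝ) [hX : Fact (0 < X)] : NormedAddCommGroup (PerC4 d X) :=
  NormedAddCommGroup.ofCore (PerC4.normCore hX.out)

noncomputable instance (d : ℕ) (X : ℝ) [hX : Fact (0 < X)] : NormedSpace ℝ (PerC4 d X) :=
  NormedSpace.ofCore (PerC4.normCore hX.out)

/-- `φ ∈ C^k([0,T]; C⁴_per)`, with one-sided time derivatives at the end points. -/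
def MemCk {d : ℕ} {X : ℝ} [Fact (0 < X)] (k : ℕ) (T : ℝ) (φ : ℝ → PerC4 d X) : Prop :=
  ContDiffOn ℝ k φ (Icc 0 T)

/-- The `C^k([0,T]; C⁴_per)` norm `max_{i ≤ k} sup_{t ∈ [0,T]} ‖∂_t^i φ(t)‖_{C⁴}` is at most `M`. -/
def CkNormLE {d : ℕ} {X : ℝ} [Fact (0 < X)] (k : ℕ) (T : ℝ) (φ : ℝ → PerC4 d X) (M : ℝ) : Prop :=
  ∀ i ≤ k, ∀ t ∈ Icc 0 T, ‖iteratedDerivWithin i φ (Icc 0 T) t‖ ≤ M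

/-! ### The local Allen–Cahn equation -/

/-- The open cube `Ω = (0,X)^d`. -/
def cube (d : ℕ) (X : ℝ) : Set (Space d) := {x | ∀ k, x k ∈ Ioo 0 X}

/-- `φ` solves `φ_t - ε² Δφ + φ³ - φ = 0` in `Ω × (0,T)`, with `φ(0) = φ₀`
(`Ω`-periodicity of `φ(t)` is part of its type). -/
structure IsLocalACSolution {d : ℕ} {X : ℝ} (ε T : ℝ) (φ₀ : PerC4 d X) (φ : ℝ → PerC4 d X) :
    Prop where
  initial : φ 0 = φ₀
  equation : ∀ t ∈ Ioo 0 T, ∀ x ∈ cube d X,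
    DifferentiableAt ℝ (fun s => φ s x) t ∧
    deriv (fun s => φ s x) t - ε ^ 2 * Laplacian.laplacian (⇑(φ t) : Space d → ℝ) x
      + (φ t x) ^ 3 - φ t x = 0

/-! ### The discrete nonlocal operator -/

/-- `ρ` is an admissible kernel with horizon `δ`: nonnegative on `[0,δ]`, with
`∫_{B_δ(0)} |s|² ρ(|s|) ds = 2d`. -/
structure IsKernel (d : ℕ) (δ : ℝ) (ρ : ℝ → ℝ) : Prop where
  nonneg : ∀ r ∈ Icc 0 δ, 0 ≤ ρ r
  integrable : IntegrableOn (fun s : Space d => ‖s‖ ^ 2 * ρ ‖s‖) (Metric.ball 0 δ)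
  second_moment : ∫ s in Metric.ball (0 : Space d) δ, ‖s‖ ^ 2 * ρ ‖s‖ = 2 * d

/-- The mesh node `h j`, for `j ∈ ℤ^d`. -/
noncomputable def node {d : ℕ} (h : ℝ) (j : Fin d → ℤ) : Space d :=
  WithLp.toLp 2 fun k => h * (j k : ℝ)

/-- The vector `1`-norm. -/
def norm1 {d : ℕ} (s : Space d) : ℝ := ∑ k, |s k|

/-- The piecewise `d`-multilinear nodal basis function `ψ_j` of the mesh of size `h`. -/
noncomputable def psi {d : ℕ} (h : ℝ) (j : Fin d → ℤ) (s : Space d) : ℝ :=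
  ∏ k, max 0 (1 - |s k - node h j k| / h)

/-- The weight `β_δ(s_j) = ½ ∫_{B_δ(0)} ψ_j(s) |s|² / ‖s‖₁ ρ(|s|) ds`. -/
noncomputable def beta {d : ℕ} (δ h : ℝ) (ρ : ℝ → ℝ) (j : Fin d → ℤ) : ℝ :=
  1 / 2 * ∫ s in Metric.ball (0 : Space d) δ, psi h j s * (‖s‖ ^ 2 / norm1 s) * ρ ‖s‖

/-- The indices `j ≠ 0` with `|j_k| ≤ ⌊δ/h⌋ + 1` for all `k`: they contain every `j ≠ 0` for which
the support of `ψ_j` meets `B_δ(0)`, see `beta_eq_zero`. -/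
noncomputable def stencil (d : ℕ) (δ h : ℝ) : Finset (Fin d → ℤ) :=
  (Fintype.piFinset fun _ => Finset.Icc (-(⌊δ / h⌋ + 1)) (⌊δ / h⌋ + 1)).erase 0

theorem beta_eq_zero {d : ℕ} {δ h : ℝ} (hh : 0 < h) (ρ : ℝ → ℝ) {j : Fin d → ℤ} (hj0 : j ≠ 0)
    (hj : j ∉ stencil d δ h) : beta δ h ρ j = 0 := by
  obtain ⟨k, hk⟩ : ∃ k, ⌊δ / h⌋ + 1 < |j k| := by
    by_contra! hcon
    exact hj (Finset.mem_erase.2 ⟨hj0, Fintype.mem_piFinset.2 fun k =>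
      Finset.mem_Icc.2 (abs_le.1 (hcon k))⟩)
  have hzero : ∀ s ∈ Metric.ball (0 : Space d) δ,
      psi h j s * (‖s‖ ^ 2 / norm1 s) * ρ ‖s‖ = 0 := by
    intro s hs
    have hs' : ‖s‖ < δ := by simpa using hs
    have hsk : |s k| < δ := lt_of_le_of_lt (by simpa using PiLp.norm_apply_le s k) hs'
    have h1 : δ / h < ⌊δ / h⌋ + 1 := Int.lt_floor_add_one _
    have h2 : ((⌊δ / h⌋ : ℝ) + 1) + 1 ≤ |(j k : ℝ)| := by exact_mod_cast hk
    have h3 : δ < h * (|(j k : ℝ)| - 1) := by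
      have := (div_lt_iff₀ hh).1 (lt_of_lt_of_le h1 (le_sub_iff_add_le.2 h2))
      linarith
    have h4 : h * |(j k : ℝ)| - |s k| ≤ |s k - node h j k| := by
      have h5 : |node h j k| = h * |(j k : ℝ)| := by
        simp [node, abs_mul, abs_of_pos hh]
      have := abs_sub_abs_le_abs_sub (node h j k) (s k)
      rw [abs_sub_comm, h5] at this
      exact this
    have h6 : 1 - |s k - node h j k| / h ≤ 0 := by
      rw [sub_nonpos, one_le_div hh]
      linarith
    have h7 : psi h j s = 0 := Finset.prod_eq_zero (Finset.mem_univ k) (max_eq_left h6)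
    simp [h7]
  rw [beta, setIntegral_congr_fun Metric.isOpen_ball.measurableSet hzero]
  simp

/-- Periodic grid functions with `N` nodes in each direction; the index `i` stands for the
nodes `h j` with `j ≡ i` modulo `N`. -/
abbrev Grid (d N : ℕ) : Type := (Fin d → ZMod N) → ℝ

/-- The limiting operator `I^h`: restriction of a (periodic) function to the mesh. -/
noncomputable def gridRestrict {d : ℕ} (N : ℕ) (h : ℝ) (u : Space d → ℝ) : Grid d N :=
  fun i => u (node h fun k => ((i k).val : ℤ))

/-- The quadrature-based finite difference operator `𝓛_{δ,h}`, that is,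
`∑_{j ≠ 0} (U(x_i + s_j) + U(x_i - s_j) - 2 U(x_i)) / |s_j|² * ‖s_j‖₁ * β_δ(s_j)`. -/
noncomputable def discreteOp {d N : ℕ} (δ h : ℝ) (ρ : ℝ → ℝ) (U : Grid d N) : Grid d N :=
  fun i => ∑ j ∈ stencil d δ h,
    (U (i + fun k => (j k : ZMod N)) + U (i - fun k => (j k : ZMod N)) - 2 * U i)
      / ‖node h j‖ ^ 2 * norm1 (node h j) * beta δ h ρ j

/-- The nonlocal stiffness matrix `D_h` of `𝓛_{δ,h}`. -/
noncomputable def stiffness {d : ℕ} (N : ℕ) (δ h : ℝ) (ρ : ℝ → ℝ) :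
    Matrix (Fin d → ZMod N) (Fin d → ZMod N) ℝ :=
  Matrix.of fun i i' => discreteOp δ h ρ (Pi.single i' 1) i

/-- `D_h U = 𝓛_{δ,h} U`. -/
theorem stiffness_mulVec {d N : ℕ} [NeZero N] (δ h : ℝ) (ρ : ℝ → ℝ) (U : Grid d N) :
    stiffness N δ h ρ *ᵥ U = discreteOp δ h ρ U := by
  have key : ∀ l : Fin d → ZMod N,
      U l = ∑ i', (Pi.single i' 1 : Grid d N) l * U i' := by
    intro l
    simp [Pi.single_apply]
  funext i
  simp only [Matrix.mulVec, dotProduct, stiffness, Matrix.of_apply, discreteOp, Finset.sum_mul]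
  rw [Finset.sum_comm]
  refine Finset.sum_congr rfl fun j _ => ?_
  conv_rhs => rw [key (i + _), key (i - _), key i]
  rw [Finset.mul_sum, ← Finset.sum_add_distrib, ← Finset.sum_sub_distrib, Finset.sum_div,
    Finset.sum_mul, Finset.sum_mul]
  refine Finset.sum_congr rfl fun i' _ => ?_
  ring

/-! ### The ETD schemes -/

/-- `L_h = -ε² D_h + κ I`. -/
noncomputable def stabOp {d : ℕ} (N : ℕ) (ε κ δ h : ℝ) (ρ : ℝ → ℝ) :
    Matrix (Fin d → ZMod N) (Fin d → ZMod N) ℝ :=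
  -(ε ^ 2) • stiffness N δ h ρ + κ • (1 : Matrix (Fin d → ZMod N) (Fin d → ZMod N) ℝ)

/-- `f(U) = (κ + 1) U - U³`, componentwise. -/
def reaction {d N : ℕ} (κ : ℝ) (U : Grid d N) : Grid d N :=
  fun i => (κ + 1) * U i - U i ^ 3

/-- One step `U ↦ e^{-Lτ} U + ∫₀^τ e^{-L(τ-s)} f(U) ds` of the ETD1 scheme. -/
noncomputable def etd1Step {d N : ℕ} [NeZero N]
    (L : Matrix (Fin d → ZMod N) (Fin d → ZMod N) ℝ) (κ τ : ℝ) (U : Grid d N) : Grid d N :=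
  NormedSpace.exp (-τ • L) *ᵥ U
    + ∫ s in (0 : ℝ)..τ, NormedSpace.exp (-(τ - s) • L) *ᵥ reaction κ U

/-- One step `U ↦ e^{-Lτ} U + ∫₀^τ e^{-L(τ-s)} [(1 - s/τ) f(U) + (s/τ) f(Ũ)] ds` of the ETDRK2
scheme, where `Ũ` is obtained from `U` by one ETD1 step. -/
noncomputable def etdrk2Step {d N : ℕ} [NeZero N]
    (L : Matrix (Fin d → ZMod N) (Fin d → ZMod N) ℝ) (κ τ : ℝ) (U : Grid d N) : Grid d N :=
  NormedSpace.exp (-τ • L) *ᵥ U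
    + ∫ s in (0 : ℝ)..τ, NormedSpace.exp (-(τ - s) • L) *ᵥ
        ((1 - s / τ) • reaction κ U + (s / τ) • reaction κ (etd1Step L κ τ U))

/-- `U⁰, …, U^K` is generated by the ETD1 scheme with time step `τ` and `U⁰ = I^h φ₀`. -/
def IsETD1 {d N : ℕ} [NeZero N] (ε κ δ h : ℝ) (ρ : ℝ → ℝ) (τ : ℝ) (K : ℕ)
    (φ₀ : Space d → ℝ) (U : ℕ → Grid d N) : Prop :=
  U 0 = gridRestrict N h φ₀ ∧ ∀ n < K, U (n + 1) = etd1Step (stabOp N ε κ δ h ρ) κ τ (U n)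

/-- `U⁰, …, U^K` is generated by the ETDRK2 scheme with time step `τ` and `U⁰ = I^h φ₀`. -/
def IsETDRK2 {d N : ℕ} [NeZero N] (ε κ δ h : ℝ) (ρ : ℝ → ℝ) (τ : ℝ) (K : ℕ)
    (φ₀ : Space d → ℝ) (U : ℕ → Grid d N) : Prop :=
  U 0 = gridRestrict N h φ₀ ∧ ∀ n < K, U (n + 1) = etdrk2Step (stabOp N ε κ δ h ρ) κ τ (U n)

end NonlocalAC

open NonlocalAC

/-! The proof is consistency plus stability in the maximum norm, with constants that do not depend
on the mesh, the horizon or the kernel.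

Consistency: a symmetric second difference of a C⁴ function equals its Hessian form up to O(|s_j|⁴).
The weight ‖s‖₁ is reproduced exactly by multilinear interpolation, so ∑ ‖s_j‖₁ β(s_j) = d for all δ
and h (`sum_norm1_mul_beta`). Reflections and permutations of the coordinates preserve the weights,
which forces exactness on all quadratic forms (`sum_weight_mul_bilin`). Only the fourth-order
remainder is left, and it is O(δ² + h²) because every contributing node satisfies |s_j|² = O(δ² +
h²) (`abs_discreteOp_sub_laplacian_le`). No relation between δ and h enters; this is the source of
asymptotic compatibility.

Stability: the weights are nonnegative, so e^{-sL} is bounded by e^{-κs}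
(`norm_exp_neg_smul_stabOp_mulVec_le`). Since |f| ≤ κ on [-1,1], both schemes preserve the unit
ball, and the parabolic maximum principle keeps |φ| ≤ 1 (`abs_le_one_of_allenCahn`). On that ball f
is Lipschitz with constant κ + 1, of which the damping absorbs κ. The net growth rate is therefore
1: a step amplifies errors by at most 1 + τ (ETD1) or 1 + τ + τ²/2 (ETDRK2), both at most e^τ.

The restricted solution satisfies the variation of constants formula with a right-hand side that
differs from that of the scheme by the consistency residual and the time discretization error
(`norm_etd_sub_le`). Summing the local errors with `le_exp_mul_of_step` gives the factor e^{t_n}.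
Joint convergence follows because a C^k function of time has bounded norm on the compact interval
[0,T]. -/

namespace NonlocalAC

/-! ### Differentiating the matrix exponential -/

section MatrixExponential

variable {ι : Type*} [Fintype ι]

/-- The action of matrices on vectors as a continuous bilinear map. -/
noncomputable def mulVecCLM : Matrix ι ι ℝ →ₗ[ℝ] (ι → ℝ) →L[ℝ] (ι → ℝ) where
  toFun A := LinearMap.toContinuousLinearMap A.mulVecLin
  map_add' A B := by ext v; simp
  map_smul' c A := by ext v; simp

theorem mulVecCLM_apply (A : Matrix ι ι ℝ) (v : ι → ℝ) : mulVecCLM A v = A *ᵥ v := rfl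

variable [DecidableEq ι]

attribute [local instance] Matrix.linftyOpNormedRing Matrix.linftyOpNormedAlgebra

theorem hasDerivAt_mulVecCLM_exp (A : Matrix ι ι ℝ) (s : ℝ) :
    HasDerivAt (fun s : ℝ => mulVecCLM (NormedSpace.exp (s • A)))
      (mulVecCLM (A * NormedSpace.exp (s • A))) s := by
  have h1 : HasDerivAt (fun s : ℝ => NormedSpace.exp (s • A)) (A * NormedSpace.exp (s • A)) s :=
    hasDerivAt_exp_smul_const' A s
  exact (LinearMap.toContinuousLinearMap (mulVecCLM (ι := ι))).hasFDerivAt.comp_hasDerivAt s h1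

end MatrixExponential

/-! ### Semigroup bounds and Duhamel's formula -/

section Semigroup

variable {ι : Type*} [Fintype ι] [DecidableEq ι]

theorem hasDerivAt_exp_mulVec (A : Matrix ι ι ℝ) {V : ℝ → ι → ℝ} {V' : ι → ℝ} {s : ℝ}
    (hV : HasDerivAt V V' s) :
    HasDerivAt (fun s : ℝ => NormedSpace.exp (s • A) *ᵥ V s)
      (NormedSpace.exp (s • A) *ᵥ (A *ᵥ V s + V')) s := by
  have h := (hasDerivAt_mulVecCLM_exp A s).clm_apply hV
  have hc : A * NormedSpace.exp (s • A) = NormedSpace.exp (s • A) * A :=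
    (((Commute.refl A).smul_left s).exp_left).eq.symm
  simp only [mulVecCLM_apply, hc] at h
  simpa [Matrix.mulVec_add, Matrix.mulVec_mulVec] using h

theorem continuous_mulVecCLM_exp (A : Matrix ι ι ℝ) :
    Continuous fun s : ℝ => mulVecCLM (NormedSpace.exp (s • A)) :=
  continuous_iff_continuousAt.2 fun s => (hasDerivAt_mulVecCLM_exp A s).continuousAt

theorem continuousOn_exp_mulVec (L : Matrix ι ι ℝ) (τ : ℝ) {F : ℝ → ι → ℝ} {S : Set ℝ}
    (hF : ContinuousOn F S) :
    ContinuousOn (fun s : ℝ => NormedSpace.exp (-(τ - s) • L) *ᵥ F s) S := by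
  have h1 : Continuous fun s : ℝ => mulVecCLM (NormedSpace.exp (-(τ - s) • L)) :=
    (continuous_mulVecCLM_exp L).comp (by fun_prop : Continuous fun s : ℝ => -(τ - s))
  exact h1.continuousOn.clm_apply hF

/-- A matrix `L` for which `μ - L` is bounded by `μ - κ` in the maximum norm generates a semigroup
`e^{-sL}` that is bounded by `e^{-κ s}`. -/
theorem norm_exp_neg_smul_mulVec_le {L : Matrix ι ι ℝ} {μ κ : ℝ}
    (hL : ∀ w : ι → ℝ, ‖μ • w - L *ᵥ w‖ ≤ (μ - κ) * ‖w‖) {s : ℝ} (hs : 0 ≤ s) (v : ι → ℝ) :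
    ‖NormedSpace.exp (-s • L) *ᵥ v‖ ≤ Real.exp (-κ * s) * ‖v‖ := by
  -- The shift by μ turns the flow into u' = (μ - L) u, whose Grönwall rate is μ - κ; dividing by
  -- e^{μs} at the end leaves e^{-κs}.
  set u : ℝ → ι → ℝ := fun s => Real.exp (μ * s) • (NormedSpace.exp (s • -L) *ᵥ v) with hu
  have hd : ∀ s, HasDerivAt u (μ • u s - L *ᵥ u s) s := by
    intro s
    have h1 := hasDerivAt_exp_mulVec (-L) (hasDerivAt_const s v)
    have h2 : HasDerivAt (fun s : ℝ => Real.exp (μ * s)) (Real.exp (μ * s) * μ) s := by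
      simpa using ((hasDerivAt_id s).const_mul μ).exp
    have hc : NormedSpace.exp (s • -L) * -L = -L * NormedSpace.exp (s • -L) :=
      (((Commute.refl (-L)).smul_left s).exp_left).eq
    have h3 : NormedSpace.exp (s • -L) *ᵥ (-L *ᵥ v) = -(L *ᵥ (NormedSpace.exp (s • -L) *ᵥ v)) := by
      rw [Matrix.mulVec_mulVec, hc, ← Matrix.mulVec_mulVec, Matrix.neg_mulVec]
    convert! h2.smul h1 using 1
    rw [add_zero, h3]
    simp only [hu, Matrix.mulVec_smul, smul_smul, smul_neg]
    rw [mul_comm μ]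
    abel
  have hb := norm_le_gronwallBound_of_norm_deriv_right_le (f := u)
    (f' := fun s => μ • u s - L *ᵥ u s) (δ := ‖v‖) (K := μ - κ) (ε := 0) (a := 0) (b := s)
    (fun t _ => (hd t).continuousAt.continuousWithinAt) (fun t _ => (hd t).hasDerivWithinAt)
    (by simp [hu]) (fun t _ => by simpa using hL (u t)) s ⟨hs, le_rfl⟩
  rw [gronwallBound_ε0, hu] at hb
  simp only [norm_smul, Real.norm_eq_abs, Real.abs_exp, sub_zero] at hb
  have h4 : -s • L = s • -L := by simp
  rw [h4]
  have h5 : Real.exp ((μ - κ) * s) = Real.exp (μ * s) * Real.exp (-κ * s) := by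
    rw [← Real.exp_add]; ring_nf
  rw [h5] at hb
  have h6 := Real.exp_pos (μ * s)
  refine le_of_mul_le_mul_left (hb.trans_eq ?_) h6
  ring

/-- Variation of constants. -/
theorem eq_exp_mulVec_add_integral {L : Matrix ι ι ℝ} {τ : ℝ} (hτ : 0 ≤ τ) {V V' : ℝ → ι → ℝ}
    (hV : ContinuousOn V (Icc 0 τ)) (hV' : ContinuousOn V' (Icc 0 τ))
    (hd : ∀ s ∈ Ioo 0 τ, HasDerivAt V (V' s) s) :
    V τ = NormedSpace.exp (-τ • L) *ᵥ V 0
      + ∫ s in (0 : ℝ)..τ, NormedSpace.exp (-(τ - s) • L) *ᵥ (V' s + L *ᵥ V s) := by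
  have hLV : ContinuousOn (fun s => L *ᵥ V s) (Icc 0 τ) :=
    (mulVecCLM L).continuous.comp_continuousOn hV
  have h := intervalIntegral.integral_eq_sub_of_hasDerivAt_of_le hτ
    (continuousOn_exp_mulVec L τ hV)
    (f' := fun s => NormedSpace.exp (-(τ - s) • L) *ᵥ (V' s + L *ᵥ V s)) ?_ ?_
  · simp only [sub_self, neg_zero, zero_smul, NormedSpace.exp_zero, Matrix.one_mulVec,
      sub_zero] at h
    rw [h]; abel
  · intro s hs
    have h1 : HasDerivAt (fun r : ℝ => mulVecCLM (NormedSpace.exp ((r - τ) • L)))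
        (mulVecCLM (L * NormedSpace.exp ((s - τ) • L))) s :=
      HasDerivAt.comp_sub_const s τ (hasDerivAt_mulVecCLM_exp L (s - τ))
    have h2 := h1.clm_apply (hd s hs)
    have hc : L * NormedSpace.exp ((s - τ) • L) = NormedSpace.exp ((s - τ) • L) * L :=
      (((Commute.refl L).smul_left _).exp_left).eq.symm
    simp only [neg_sub]
    convert! h2 using 1
    rw [mulVecCLM_apply, hc, mulVecCLM_apply, Matrix.mulVec_add, Matrix.mulVec_mulVec, add_comm]
  · exact ((continuousOn_exp_mulVec L τ (hV'.add hLV)).mono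
      (by rw [uIcc_of_le hτ])).intervalIntegrable

/-- Kept in closed form: in the one-step estimates the terms in 1 - e^{-κτ} must cancel exactly
against the damping e^{-κτ}. -/
theorem integral_exp_mul_affine {κ : ℝ} (hκ : κ ≠ 0) (τ p q : ℝ) :
    ∫ s in (0 : ℝ)..τ, Real.exp (-κ * (τ - s)) * (p + q * s)
      = (p / κ) * (1 - Real.exp (-κ * τ)) + q * (τ / κ - (1 - Real.exp (-κ * τ)) / κ ^ 2) := by
  have h : ∀ s, HasDerivAt
      (fun s => Real.exp (-κ * (τ - s)) * (p / κ + q * (s / κ - 1 / κ ^ 2)))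
      (Real.exp (-κ * (τ - s)) * (p + q * s)) s := by
    intro s
    have h1 : HasDerivAt (fun s => Real.exp (-κ * (τ - s))) (Real.exp (-κ * (τ - s)) * κ) s := by
      simpa using (((hasDerivAt_id s).const_sub τ).const_mul (-κ)).exp
    have h2 : HasDerivAt (fun s => p / κ + q * (s / κ - 1 / κ ^ 2)) (q * (1 / κ)) s :=
      ((((hasDerivAt_id s).div_const κ).sub_const _).const_mul q).const_add _
    convert! h1.mul h2 using 1
    field_simp
    ring
  rw [intervalIntegral.integral_eq_sub_of_hasDerivAt (fun s _ => h s)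
    (Continuous.intervalIntegrable (by fun_prop) _ _)]
  simp
  field_simp
  ring

/-- The Duhamel formula bounded by `e^{-κτ} ‖W‖ + ∫₀^τ e^{-κ(τ-s)} (p + q s) ds`. -/
theorem norm_duhamel_le {L : Matrix ι ι ℝ} {κ τ p q : ℝ} (hκ : κ ≠ 0) (hτ : 0 ≤ τ)
    (hL : ∀ s, 0 ≤ s → ∀ v, ‖NormedSpace.exp (-s • L) *ᵥ v‖ ≤ Real.exp (-κ * s) * ‖v‖)
    (W : ι → ℝ) {G : ℝ → ι → ℝ} (hG : ∀ s ∈ Ioc 0 τ, ‖G s‖ ≤ p + q * s) :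
    ‖NormedSpace.exp (-τ • L) *ᵥ W + ∫ s in (0 : ℝ)..τ, NormedSpace.exp (-(τ - s) • L) *ᵥ G s‖
      ≤ Real.exp (-κ * τ) * ‖W‖ + ((p / κ) * (1 - Real.exp (-κ * τ))
        + q * (τ / κ - (1 - Real.exp (-κ * τ)) / κ ^ 2)) := by
  rw [← integral_exp_mul_affine hκ]
  refine (norm_add_le _ _).trans (add_le_add (hL τ hτ W) ?_)
  refine intervalIntegral.norm_integral_le_of_norm_le hτ ?_
    (Continuous.intervalIntegrable (by fun_prop) _ _)
  refine Filter.Eventually.of_forall fun s hs => (hL _ (sub_nonneg.2 hs.2) _).trans ?_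
  exact mul_le_mul_of_nonneg_left (hG s hs) (Real.exp_pos _).le

/-- The error of one exponential time differencing step whose right-hand side `F` approximates
`V' + L V` up to `p + q s`. -/
theorem norm_etd_sub_le {L : Matrix ι ι ℝ} {κ τ p q : ℝ} (hκ : κ ≠ 0) (hτ : 0 ≤ τ)
    (hL : ∀ s, 0 ≤ s → ∀ v, ‖NormedSpace.exp (-s • L) *ᵥ v‖ ≤ Real.exp (-κ * s) * ‖v‖)
    {V V' F : ℝ → ι → ℝ} (hV : ContinuousOn V (Icc 0 τ)) (hV' : ContinuousOn V' (Icc 0 τ))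
    (hd : ∀ s ∈ Ioo 0 τ, HasDerivAt V (V' s) s) (hF : ContinuousOn F (Icc 0 τ)) (W : ι → ℝ)
    (hG : ∀ s ∈ Icc 0 τ, ‖F s - (V' s + L *ᵥ V s)‖ ≤ p + q * s) :
    ‖NormedSpace.exp (-τ • L) *ᵥ W + (∫ s in (0 : ℝ)..τ, NormedSpace.exp (-(τ - s) • L) *ᵥ F s)
        - V τ‖
      ≤ Real.exp (-κ * τ) * ‖W - V 0‖ + ((p / κ) * (1 - Real.exp (-κ * τ))
        + q * (τ / κ - (1 - Real.exp (-κ * τ)) / κ ^ 2)) := by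
  have hLV : ContinuousOn (fun s => L *ᵥ V s) (Icc 0 τ) :=
    (mulVecCLM L).continuous.comp_continuousOn hV
  have hi : ∀ {H : ℝ → ι → ℝ}, ContinuousOn H (Icc 0 τ) → IntervalIntegrable
      (fun s => NormedSpace.exp (-(τ - s) • L) *ᵥ H s) volume 0 τ := fun hH =>
    ((continuousOn_exp_mulVec L τ hH).mono (by rw [uIcc_of_le hτ])).intervalIntegrable
  -- V satisfies Duhamel's formula with forcing V' + LV, so the error is itself a Duhamel expression
  -- with initial value W - V 0 and forcing F - (V' + LV).
  have h := norm_duhamel_le hκ hτ hL (W - V 0) (p := p) (q := q)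
    (G := fun s => F s - (V' s + L *ᵥ V s)) fun s hs => hG s (Ioc_subset_Icc_self hs)
  convert h using 2
  rw [eq_exp_mulVec_add_integral (L := L) hτ hV hV' hd]
  have h1 := intervalIntegral.integral_sub (hi hF) (hi (H := fun s => V' s + L *ᵥ V s)
    (hV'.add hLV))
  simp only [Matrix.mulVec_sub]
  rw [h1]
  abel

end Semigroup

/-! ### One-dimensional hat functions -/

section Hat

/-- The sum of a function against the hat functions is its piecewise linear interpolant. -/
theorem sum_mul_hat {δ h t : ℝ} (hh : 0 < h) (ht : |t| < δ) (g : ℤ → ℝ) :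
    ∑ m ∈ Finset.Icc (-(⌊δ / h⌋ + 1)) (⌊δ / h⌋ + 1), g m * max 0 (1 - |t - h * m| / h)
      = g ⌊t / h⌋ * (1 - Int.fract (t / h)) + g (⌊t / h⌋ + 1) * Int.fract (t / h) := by
  set a := t / h with ha
  set n := ⌊a⌋ with hn
  have hta : t = h * a := by rw [ha]; field_simp
  have hat : ∀ m : ℤ, |t - h * m| / h = |a - m| := by
    intro m
    rw [hta, ← mul_sub, abs_mul, abs_of_pos hh]
    field_simp
  have h0 := Int.fract_nonneg a
  have h1 := Int.fract_lt_one a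
  have hfa : a = n + Int.fract a := (Int.floor_add_fract a).symm
  have hlt : |a| < δ / h := by
    rw [ha, abs_div, abs_of_pos hh]; gcongr
  have hδ : δ / h < ⌊δ / h⌋ + 1 := Int.lt_floor_add_one _
  obtain ⟨hl1, hl2⟩ := abs_lt.1 hlt
  have hn1 : n ≤ ⌊δ / h⌋ := Int.floor_le_floor hl2.le
  have hn2 : -(⌊δ / h⌋ + 1) ≤ n := Int.le_floor.2 (by push_cast; linarith)
  -- Only the two nodes enclosing t contribute. The extra layer in ⌊δ/h⌋ + 1 ensures that both are
  -- in range for either sign of t.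
  have hsub : ({n, n + 1} : Finset ℤ) ⊆ Finset.Icc (-(⌊δ / h⌋ + 1)) (⌊δ / h⌋ + 1) := by
    intro m hm
    simp only [Finset.mem_insert, Finset.mem_singleton] at hm
    rw [Finset.mem_Icc]
    rcases hm with rfl | rfl <;> constructor <;> omega
  rw [← Finset.sum_subset hsub]
  · rw [Finset.sum_pair (by omega)]
    simp only [hat]
    have e1 : |a - n| = Int.fract a := by
      rw [show a - n = Int.fract a from rfl, abs_of_nonneg h0]
    have e2 : |a - ((n + 1 : ℤ) : ℝ)| = 1 - Int.fract a := by
      push_cast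
      rw [abs_of_neg] <;> linarith
    rw [e1, e2, max_eq_right (by linarith), max_eq_right (by linarith)]
    ring
  · intro m _ hm
    simp only [Finset.mem_insert, Finset.mem_singleton, not_or] at hm
    rw [hat, max_eq_left, mul_zero]
    rw [sub_nonpos]
    rcases lt_or_gt_of_ne hm.1 with h2 | h2
    · have : (m : ℝ) + 1 ≤ n := by exact_mod_cast h2
      exact le_trans (by linarith) (le_abs_self _)
    · have h3 : n + 2 ≤ m := by omega
      have : (n : ℝ) + 2 ≤ m := by exact_mod_cast h3
      exact le_trans (by linarith) (neg_le_abs _)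

theorem sum_hat {δ h t : ℝ} (hh : 0 < h) (ht : |t| < δ) :
    ∑ m ∈ Finset.Icc (-(⌊δ / h⌋ + 1)) (⌊δ / h⌋ + 1), max 0 (1 - |t - h * m| / h) = 1 := by
  simpa using sum_mul_hat hh ht 1

/-- The kink of |·| is at 0, which is a node, so |·| is affine on every cell and equals its
piecewise linear interpolant. -/
theorem sum_abs_mul_hat {δ h t : ℝ} (hh : 0 < h) (ht : |t| < δ) :
    ∑ m ∈ Finset.Icc (-(⌊δ / h⌋ + 1)) (⌊δ / h⌋ + 1), |h * m| * max 0 (1 - |t - h * m| / h)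
      = |t| := by
  rw [sum_mul_hat hh ht fun m => |h * m|]
  have hta : t = h * (⌊t / h⌋ + Int.fract (t / h)) := by
    rw [Int.floor_add_fract]; field_simp
  have h0 := Int.fract_nonneg (t / h)
  have h1 := Int.fract_lt_one (t / h)
  conv_rhs => rw [hta]
  simp only [abs_mul, abs_of_pos hh]
  rcases le_or_gt 0 ⌊t / h⌋ with h2 | h2
  · have h3 : (0 : ℝ) ≤ ⌊t / h⌋ := by exact_mod_cast h2
    push_cast
    rw [abs_of_nonneg h3, abs_of_nonneg (by linarith : (0 : ℝ) ≤ ⌊t / h⌋ + 1),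
      abs_of_nonneg (by linarith : (0 : ℝ) ≤ ⌊t / h⌋ + Int.fract (t / h))]
    ring
  · have h3 : (⌊t / h⌋ : ℝ) + 1 ≤ 0 := by exact_mod_cast h2
    push_cast
    rw [abs_of_nonpos (by linarith : (⌊t / h⌋ : ℝ) ≤ 0), abs_of_nonpos h3,
      abs_of_nonpos (by linarith : (⌊t / h⌋ : ℝ) + Int.fract (t / h) ≤ 0)]
    ring

end Hat

/-! ### Quadrature weights: integrability, sign, reach and total mass -/

section Weights

variable {d : ℕ} {δ h : ℝ} {ρ : ℝ → ℝ}

theorem node_apply (h : ℝ) (j : Fin d → ℤ) (k : Fin d) : node h j k = h * j k := rfl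

theorem norm1_nonneg (s : Space d) : 0 ≤ norm1 s := Finset.sum_nonneg fun _ _ => abs_nonneg _

theorem continuous_norm1 : Continuous (norm1 : Space d → ℝ) := by
  unfold norm1; fun_prop

theorem norm1_eq_zero {s : Space d} (hs : norm1 s = 0) : s = 0 := by
  ext k
  have := (Finset.sum_eq_zero_iff_of_nonneg fun k _ => abs_nonneg (s k)).1 hs k (Finset.mem_univ k)
  simpa using this

theorem psi_nonneg (h : ℝ) (j : Fin d → ℤ) (s : Space d) : 0 ≤ psi h j s :=
  Finset.prod_nonneg fun _ _ => le_max_left _ _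

theorem continuous_psi (h : ℝ) (j : Fin d → ℤ) : Continuous (psi h j : Space d → ℝ) := by
  unfold psi; fun_prop

/-- For j ≠ 0 the function ψ_j vanishes at the origin, and at least linearly. This compensates the
singular factor 1/‖s‖₁ in the definition of `beta`. -/
theorem psi_le_norm1_div (hh : 0 < h) {j : Fin d → ℤ} (hj : j ≠ 0) (s : Space d) :
    psi h j s ≤ norm1 s / h := by
  obtain ⟨k, hk⟩ := Function.ne_iff.1 hj
  have hk1 : (1 : ℝ) ≤ |(j k : ℝ)| := by exact_mod_cast Int.one_le_abs hk
  have h1 : psi h j s ≤ max 0 (1 - |s k - node h j k| / h) := by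
    unfold psi
    rw [← Finset.mul_prod_erase _ _ (Finset.mem_univ k)]
    refine mul_le_of_le_one_right (le_max_left _ _) (Finset.prod_le_one
      (fun _ _ => le_max_left _ _) fun i _ => max_le zero_le_one ?_)
    have := div_nonneg (abs_nonneg (s i - node h j i)) hh.le
    linarith
  have h2 : |s k| ≤ norm1 s :=
    Finset.single_le_sum (f := fun k => |s k|) (fun _ _ => abs_nonneg _) (Finset.mem_univ k)
  refine h1.trans (max_le (div_nonneg (norm1_nonneg s) hh.le) ?_)
  rw [sub_le_iff_le_add, ← add_div, one_le_div hh]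
  have h3 := abs_sub_abs_le_abs_sub (node h j k) (s k)
  rw [abs_sub_comm, node_apply, abs_mul, abs_of_pos hh] at h3
  rw [node_apply]
  nlinarith

theorem integrableOn_psi_mul (hh : 0 < h) (hρ : IsKernel d δ ρ) {j : Fin d → ℤ} (hj : j ≠ 0) :
    IntegrableOn (fun s : Space d => psi h j s * (‖s‖ ^ 2 / norm1 s) * ρ ‖s‖)
      (Metric.ball 0 δ) := by
  have h1 : IntegrableOn (fun s : Space d => psi h j s / norm1 s * (‖s‖ ^ 2 * ρ ‖s‖))
      (Metric.ball 0 δ) := by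
    refine Integrable.bdd_mul hρ.integrable (c := 1 / h)
      ((continuous_psi h j).measurable.div continuous_norm1.measurable).aestronglyMeasurable
      (Filter.Eventually.of_forall fun s => ?_)
    rw [Real.norm_of_nonneg (div_nonneg (psi_nonneg _ _ _) (norm1_nonneg _))]
    rcases (norm1_nonneg s).eq_or_lt with h0 | h0
    · rw [← h0, div_zero]; positivity
    · rw [div_le_iff₀ h0, one_div_mul_eq_div]
      exact psi_le_norm1_div hh hj s
  refine h1.congr (Filter.Eventually.of_forall fun s => ?_)
  simp only
  ring

theorem beta_nonneg (hρ : IsKernel d δ ρ) (h : ℝ) (j : Fin d → ℤ) : 0 ≤ beta δ h ρ j := by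
  refine mul_nonneg (by norm_num) (setIntegral_nonneg measurableSet_ball fun s hs => ?_)
  have hs' : ‖s‖ < δ := by simpa using hs
  exact mul_nonneg (mul_nonneg (psi_nonneg _ _ _) (div_nonneg (sq_nonneg _) (norm1_nonneg _)))
    (hρ.nonneg _ ⟨norm_nonneg _, hs'.le⟩)

/-- A contributing node is within h, in each coordinate, of some point of the ball; (a + b)² ≤ 2a² +
2b² is then summed over d coordinates. -/
theorem norm_node_sq_le_of_beta_ne_zero (hh : 0 < h) {j : Fin d → ℤ} (hj : beta δ h ρ j ≠ 0) :
    ‖node h j‖ ^ 2 ≤ 2 * δ ^ 2 + 2 * d * h ^ 2 := by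
  obtain ⟨s, hs, hψ⟩ : ∃ s ∈ Metric.ball (0 : Space d) δ, psi h j s ≠ 0 := by
    by_contra! hcon
    refine hj ?_
    rw [beta, setIntegral_congr_fun (g := fun _ => 0) measurableSet_ball
      fun s hs => by simp [hcon s hs]]
    simp
  have hs' : ‖s‖ < δ := by simpa using hs
  have hk : ∀ k, ‖node h j k‖ ^ 2 ≤ 2 * ‖s k‖ ^ 2 + 2 * h ^ 2 := by
    intro k
    have h1 : max 0 (1 - |s k - node h j k| / h) ≠ 0 :=
      Finset.prod_ne_zero_iff.1 hψ k (Finset.mem_univ k)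
    have h2 : |s k - node h j k| < h := by
      by_contra! hcon
      exact h1 (max_eq_left (by rw [sub_nonpos, one_le_div hh]; exact hcon))
    have h3 : (s k - node h j k) ^ 2 ≤ h ^ 2 := sq_le_sq' (by linarith [abs_lt.1 h2]) (abs_lt.1 h2).2.le
    simp only [Real.norm_eq_abs, sq_abs]
    nlinarith [sq_nonneg (s k + (s k - node h j k))]
  rw [EuclideanSpace.norm_sq_eq]
  calc ∑ k, ‖node h j k‖ ^ 2 ≤ ∑ k, (2 * ‖s k‖ ^ 2 + 2 * h ^ 2) := Finset.sum_le_sum fun k _ => hk k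
    _ = 2 * ‖s‖ ^ 2 + 2 * d * h ^ 2 := by
      rw [Finset.sum_add_distrib, ← Finset.mul_sum, ← EuclideanSpace.norm_sq_eq]
      simp; ring
    _ ≤ _ := by gcongr

/-- Here the choice of the 1-norm pays off: a sum of the |s_i| is reproduced exactly by
interpolation. The sum over the box factors; the i-th factor gives |s_i| and the others are
partitions of unity. The omitted index 0 would contribute nothing. -/
theorem sum_norm1_mul_psi (hh : 0 < h) {s : Space d} (hs : ‖s‖ < δ) :
    ∑ j ∈ stencil d δ h, norm1 (node h j) * psi h j s = norm1 s := by
  have hsk : ∀ k, |s k| < δ := fun k =>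
    lt_of_le_of_lt (by simpa using PiLp.norm_apply_le s k) hs
  rw [stencil, Finset.sum_erase _ (by simp [norm1, node_apply])]
  simp only [norm1, Finset.sum_mul]
  rw [Finset.sum_comm]
  refine Finset.sum_congr rfl fun i _ => ?_
  set hat : Fin d → ℤ → ℝ := fun k m => max 0 (1 - |s k - h * m| / h)
  have h1 : ∀ j : Fin d → ℤ, |node h j i| * psi h j s
      = ∏ k, (if k = i then |h * (j k : ℝ)| else 1) * hat k (j k) := by
    intro j
    rw [Finset.prod_mul_distrib, Finset.prod_ite_eq' Finset.univ i (fun k => |h * (j k : ℝ)|)]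
    simp [psi, node_apply, hat]
  simp only [h1]
  rw [← Finset.prod_univ_sum (fun _ => Finset.Icc (-(⌊δ / h⌋ + 1)) (⌊δ / h⌋ + 1))
    (fun k m => (if k = i then |h * (m : ℝ)| else 1) * hat k m)]
  rw [Finset.prod_eq_single i]
  · simp only [if_true]
    exact sum_abs_mul_hat hh (hsk i)
  · intro k _ hk
    simp only [if_neg hk, one_mul]
    exact sum_hat hh (hsk k)
  · simp

/-- Interpolating ‖s‖₁ cancels the denominator in `beta`, which leaves half of the second moment 2d.
-/
theorem sum_norm1_mul_beta (hh : 0 < h) (hρ : IsKernel d δ ρ) :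
    ∑ j ∈ stencil d δ h, norm1 (node h j) * beta δ h ρ j = d := by
  have h1 : ∀ j ∈ stencil d δ h, norm1 (node h j) * beta δ h ρ j
      = 1 / 2 * ∫ s in Metric.ball (0 : Space d) δ,
          norm1 (node h j) * (psi h j s * (‖s‖ ^ 2 / norm1 s) * ρ ‖s‖) := by
    intro j _
    rw [integral_const_mul, beta]; ring
  rw [Finset.sum_congr rfl h1, ← Finset.mul_sum, ← integral_finsetSum]
  · rw [setIntegral_congr_fun (g := fun s : Space d => ‖s‖ ^ 2 * ρ ‖s‖) measurableSet_ball,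
      hρ.second_moment]
    · ring
    · intro s hs
      have h2 : ∀ j, norm1 (node h j) * (psi h j s * (‖s‖ ^ 2 / norm1 s) * ρ ‖s‖)
          = norm1 (node h j) * psi h j s * ((‖s‖ ^ 2 / norm1 s) * ρ ‖s‖) := fun j => by ring
      simp only [h2]
      rw [← Finset.sum_mul, sum_norm1_mul_psi hh (by simpa using hs)]
      by_cases h0 : norm1 s = 0
      · simp [norm1_eq_zero h0]
      · field_simp
  · exact fun j hj => (integrableOn_psi_mul hh hρ (Finset.mem_erase.1 hj).1).const_mul _

end Weights

/-! ### Symmetries of the weights and exactness on quadratic forms -/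

section Symmetry

variable {d : ℕ} {δ h : ℝ} {ρ : ℝ → ℝ}

/-- Change of variables: a linear isometry preserves Lebesgue measure, the ball and the radial
kernel. -/
theorem beta_eq_of_isometry (A : Space d ≃ₗᵢ[ℝ] Space d) {j j' : Fin d → ℤ}
    (hn : ∀ s, norm1 (A s) = norm1 s) (hp : ∀ s, psi h j' (A s) = psi h j s) :
    beta δ h ρ j' = beta δ h ρ j := by
  have h1 := A.measurePreserving.setIntegral_preimage_emb
    A.toHomeomorph.measurableEmbedding
    (fun s : Space d => psi h j' s * (‖s‖ ^ 2 / norm1 s) * ρ ‖s‖) (Metric.ball 0 δ)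
  rw [beta, beta, ← h1]
  have h2 : A ⁻¹' Metric.ball 0 δ = Metric.ball 0 δ := by ext s; simp
  simp only [h2, hn, hp, LinearIsometryEquiv.norm_map]

/-- The sign change of the `i`-th coordinate of an index. -/
def flipIndex (i : Fin d) (j : Fin d → ℤ) : Fin d → ℤ := fun k => if k = i then -j k else j k

theorem flipIndex_involutive (i : Fin d) : Function.Involutive (flipIndex i) := by
  intro j; funext k; by_cases hk : k = i <;> simp [flipIndex, hk]

/-- The reflection in the `i`-th coordinate. -/
noncomputable def coordReflection (i : Fin d) : Space d ≃ₗᵢ[ℝ] Space d :=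
  LinearIsometryEquiv.piLpCongrRight 2 fun k =>
    if k = i then LinearIsometryEquiv.neg ℝ else LinearIsometryEquiv.refl ℝ ℝ

theorem coordReflection_apply (i : Fin d) (s : Space d) (k : Fin d) :
    coordReflection i s k = if k = i then -s k else s k := by
  by_cases hk : k = i <;> simp [coordReflection, hk]

theorem beta_flipIndex (i : Fin d) (j : Fin d → ℤ) :
    beta δ h ρ (flipIndex i j) = beta δ h ρ j := by
  refine beta_eq_of_isometry (coordReflection i) (fun s => ?_) fun s => ?_
  · refine Finset.sum_congr rfl fun k _ => ?_
    rw [coordReflection_apply]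
    split_ifs <;> simp
  · refine Finset.prod_congr rfl fun k _ => ?_
    rw [coordReflection_apply, node_apply, node_apply, flipIndex]
    split_ifs
    · congr 3
      push_cast
      rw [← abs_neg]; congr 1; ring
    · rfl

theorem beta_comp_perm (σ : Equiv.Perm (Fin d)) (j : Fin d → ℤ) :
    beta δ h ρ (j ∘ σ) = beta δ h ρ j := by
  refine beta_eq_of_isometry (LinearIsometryEquiv.piLpCongrLeft 2 ℝ ℝ σ.symm) (fun s => ?_)
    fun s => ?_
  · simp only [norm1, LinearIsometryEquiv.piLpCongrLeft_apply]
    exact Equiv.sum_comp σ fun k => |s k|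
  · simp only [psi, LinearIsometryEquiv.piLpCongrLeft_apply]
    exact Equiv.prod_comp σ fun k => max 0 (1 - |s k - node h j k| / h)

theorem mem_stencil {j : Fin d → ℤ} : j ∈ stencil d δ h ↔ j ≠ 0 ∧ ∀ k, |j k| ≤ ⌊δ / h⌋ + 1 := by
  simp [stencil, abs_le]

/-- The weight with which `U(x_i + s_j) + U(x_i - s_j) - 2 U(x_i)` enters `𝓛_{δ,h} U`. -/
noncomputable def weight (δ h : ℝ) (ρ : ℝ → ℝ) (j : Fin d → ℤ) : ℝ :=
  norm1 (node h j) * beta δ h ρ j / ‖node h j‖ ^ 2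

theorem weight_nonneg (hρ : IsKernel d δ ρ) (h : ℝ) (j : Fin d → ℤ) : 0 ≤ weight δ h ρ j :=
  div_nonneg (mul_nonneg (norm1_nonneg _) (beta_nonneg hρ h j)) (sq_nonneg _)

theorem weight_flipIndex (i : Fin d) (j : Fin d → ℤ) :
    weight δ h ρ (flipIndex i j) = weight δ h ρ j := by
  have h1 : ∀ k, |node h (flipIndex i j) k| = |node h j k| := by
    intro k
    rw [node_apply, node_apply, flipIndex]
    split_ifs <;> simp
  have h2 : ‖node h (flipIndex i j)‖ ^ 2 = ‖node h j‖ ^ 2 := by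
    simp only [EuclideanSpace.norm_sq_eq, Real.norm_eq_abs, h1]
  rw [weight, weight, beta_flipIndex, h2]
  simp only [norm1, h1]

theorem weight_comp_perm (σ : Equiv.Perm (Fin d)) (j : Fin d → ℤ) :
    weight δ h ρ (j ∘ σ) = weight δ h ρ j := by
  have h2 : ‖node h (j ∘ σ)‖ ^ 2 = ‖node h j‖ ^ 2 := by
    simp only [EuclideanSpace.norm_sq_eq]
    exact Equiv.sum_comp σ fun k => ‖node h j k‖ ^ 2
  have h1 : norm1 (node h (j ∘ σ)) = norm1 (node h j) :=
    Equiv.sum_comp σ fun k => |node h j k|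
  rw [weight, weight, beta_comp_perm, h2, h1]

/-- Reflecting the i-th coordinate permutes the stencil, fixes the weights and reverses the sign of
the product. -/
theorem sum_weight_mul_of_ne {i k : Fin d} (hik : i ≠ k) :
    ∑ j ∈ stencil d δ h, weight δ h ρ j * (node h j i * node h j k) = 0 := by
  have h1 : ∑ j ∈ stencil d δ h, weight δ h ρ j * (node h j i * node h j k)
      = ∑ j ∈ stencil d δ h, -(weight δ h ρ j * (node h j i * node h j k)) := by
    refine Finset.sum_equiv (flipIndex_involutive i).toPerm (fun j => ?_) fun j _ => ?_
    · have h3 : flipIndex i j = 0 ↔ j = 0 :=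
        ⟨fun h => by rw [← flipIndex_involutive i j, h]; funext; simp [flipIndex],
          fun h => by subst h; funext; simp [flipIndex]⟩
      have h4 : ∀ k, |flipIndex i j k| = |j k| := by
        intro k; rw [flipIndex]; split_ifs <;> simp
      simp [mem_stencil, h3, h4]
    · rw [Function.Involutive.coe_toPerm, weight_flipIndex]
      simp [node_apply, flipIndex, hik.symm]
  rw [Finset.sum_neg_distrib] at h1
  linarith

theorem sum_weight_mul_sq_eq (i k : Fin d) :
    ∑ j ∈ stencil d δ h, weight δ h ρ j * node h j i ^ 2
      = ∑ j ∈ stencil d δ h, weight δ h ρ j * node h j k ^ 2 := by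
  have hinv : Function.Involutive fun j : Fin d → ℤ => j ∘ Equiv.swap i k := by
    intro j; funext l; simp
  refine Finset.sum_equiv hinv.toPerm (fun j => ?_) fun j _ => ?_
  · have h3 : j ∘ Equiv.swap i k = 0 ↔ j = 0 :=
      ⟨fun h => by rw [← hinv j]; simp [h], fun h => by subst h; rfl⟩
    have h4 : (∀ l, |j (Equiv.swap i k l)| ≤ ⌊δ / h⌋ + 1) ↔ ∀ l, |j l| ≤ ⌊δ / h⌋ + 1 :=
      (Equiv.swap i k).forall_congr_left.trans (by simp)
    simp only [mem_stencil, Function.Involutive.coe_toPerm, ne_eq, h3, Function.comp_apply, h4]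
  · rw [Function.Involutive.coe_toPerm, weight_comp_perm]
    simp [node_apply]

theorem norm_node_sq_pos (hh : 0 < h) {j : Fin d → ℤ} (hj : j ≠ 0) : 0 < ‖node h j‖ ^ 2 := by
  obtain ⟨k, hk⟩ := Function.ne_iff.1 hj
  have : node h j ≠ 0 := fun h0 => by
    have h1 : node h j k = 0 := by rw [h0]; rfl
    rw [node_apply] at h1
    exact (mul_ne_zero hh.ne' (by exact_mod_cast hk)) h1
  positivity

theorem weight_mul_norm_sq (hh : 0 < h) {j : Fin d → ℤ} (hj : j ≠ 0) :
    weight δ h ρ j * ‖node h j‖ ^ 2 = norm1 (node h j) * beta δ h ρ j := by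
  rw [weight, div_mul_cancel₀ _ (norm_node_sq_pos hh hj).ne']

theorem sum_weight_mul_norm_sq (hh : 0 < h) (hρ : IsKernel d δ ρ) :
    ∑ j ∈ stencil d δ h, weight δ h ρ j * ‖node h j‖ ^ 2 = d := by
  rw [← sum_norm1_mul_beta hh hρ]
  exact Finset.sum_congr rfl fun j hj => weight_mul_norm_sq hh (Finset.mem_erase.1 hj).1

theorem sum_weight_mul_sq (hh : 0 < h) (hρ : IsKernel d δ ρ) (i : Fin d) :
    ∑ j ∈ stencil d δ h, weight δ h ρ j * node h j i ^ 2 = 1 := by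
  have h1 : ∑ k, ∑ j ∈ stencil d δ h, weight δ h ρ j * node h j k ^ 2 = d := by
    rw [Finset.sum_comm, ← sum_weight_mul_norm_sq hh hρ]
    refine Finset.sum_congr rfl fun j _ => ?_
    rw [← Finset.mul_sum, EuclideanSpace.norm_sq_eq]
    simp
  rw [Finset.sum_congr rfl fun k _ => sum_weight_mul_sq_eq k i] at h1
  have hd : (0 : ℝ) < d := by exact_mod_cast i.pos
  simp only [Finset.sum_const, Finset.card_univ, Fintype.card_fin, nsmul_eq_mul] at h1
  -- The d coordinate moments are equal and add up to d, so each is 1.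
  exact mul_left_cancel₀ hd.ne' (by linarith)

/-- The quadrature is exact on quadratic forms. -/
theorem sum_weight_mul_bilin (hh : 0 < h) (hρ : IsKernel d δ ρ)
    (B : Space d →ₗ[ℝ] Space d →ₗ[ℝ] ℝ) :
    ∑ j ∈ stencil d δ h, weight δ h ρ j * B (node h j) (node h j)
      = ∑ i, B (EuclideanSpace.single i 1) (EuclideanSpace.single i 1) := by
  have hB : ∀ s : Space d, B s s = ∑ i, ∑ k, s i * s k *
      B (EuclideanSpace.single i 1) (EuclideanSpace.single k 1) := by
    intro s
    have hs : s = ∑ i, s i • (EuclideanSpace.single i 1 : Space d) := by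
      ext k; simp [Pi.single_apply]
    conv_lhs => rw [hs]
    simp only [map_sum, LinearMap.sum_apply, map_smul, LinearMap.smul_apply, smul_eq_mul,
      Finset.mul_sum, mul_assoc]
    rw [Finset.sum_comm]
    exact Finset.sum_congr rfl fun i _ => Finset.sum_congr rfl fun k _ => by ring
  have h1 : ∀ i k, ∑ j ∈ stencil d δ h, weight δ h ρ j * (node h j i * node h j k *
      B (EuclideanSpace.single i 1) (EuclideanSpace.single k 1))
      = if i = k then B (EuclideanSpace.single i 1) (EuclideanSpace.single k 1) else 0 := by
    intro i k
    simp only [← mul_assoc]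
    rw [← Finset.sum_mul]
    simp only [mul_assoc]
    split_ifs with hik
    · subst hik
      simp only [← sq, sum_weight_mul_sq hh hρ i, one_mul]
    · rw [sum_weight_mul_of_ne hik, zero_mul]
  simp only [hB, Finset.mul_sum]
  rw [Finset.sum_comm]
  refine Finset.sum_congr rfl fun i _ => ?_
  rw [Finset.sum_comm, Finset.sum_congr rfl fun k _ => h1 i k]
  simp

theorem discreteOp_eq {N : ℕ} (U : Grid d N) (i : Fin d → ZMod N) :
    discreteOp δ h ρ U i = ∑ j ∈ stencil d δ h, weight δ h ρ j *
      (U (i + fun k => (j k : ZMod N)) + U (i - fun k => (j k : ZMod N)) - 2 * U i) := by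
  rw [discreteOp]
  exact Finset.sum_congr rfl fun j _ => by rw [weight]; ring

end Symmetry

/-! ### Periodicity and reduction to the period cell -/

section Periodic

variable {d : ℕ} {X : ℝ}

theorem IsCubePeriodic.add_node {F : Type*} {u : Space d → F} (hu : IsCubePeriodic d X u)
    (x : Space d) (m : Fin d → ℤ) : u (x + node X m) = u x := by
  have hper : ∀ s : Finset (Fin d),
      Function.Periodic u (∑ k ∈ s, m k • EuclideanSpace.single k X) := by
    intro s
    induction s using Finset.induction_on with
    | empty => intro x; simp
    | insert a s ha ih =>
      rw [Finset.sum_insert ha]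
      exact ((hu a).zsmul (m a)).add_period ih
  have h1 : node X m = ∑ k, m k • (EuclideanSpace.single k X : Space d) := by
    ext k
    simp [node_apply, Pi.single_apply, mul_comm]
  rw [h1]
  exact hper _ x

/-- Every point is equivalent to a point of the half-open period cell. -/
theorem exists_add_node_mem (hX : 0 < X) (x : Space d) :
    ∃ m : Fin d → ℤ, ∀ k, (x + node X m) k ∈ Ico 0 X := by
  refine ⟨fun k => -⌊x k / X⌋, fun k => ?_⟩
  have h0 := Int.fract_nonneg (x k / X)
  have h1 := Int.fract_lt_one (x k / X)
  have h2 : (x + node X fun k => -⌊x k / X⌋) k = X * Int.fract (x k / X) := by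
    have h3 : X * (x k / X) = x k := by field_simp
    rw [PiLp.add_apply, node_apply, ← Int.self_sub_floor, mul_sub, h3]
    push_cast
    ring
  rw [h2]
  exact ⟨by positivity, by nlinarith⟩

theorem IsCubePeriodic.eq_zero (hX : 0 < X) {g : Space d → ℝ} (hg : IsCubePeriodic d X g)
    (hc : Continuous g) (h0 : ∀ x ∈ cube d X, g x = 0) (x : Space d) : g x = 0 := by
  obtain ⟨m, hm⟩ := exists_add_node_mem hX x
  rw [← hg.add_node x m]
  set y := x + node X m
  -- The diagonal direction leads from any point of the half-open cell into the open cube, so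
  -- continuity covers its boundary faces.
  set e : Space d := WithLp.toLp 2 fun _ => 1
  have h1 : Filter.Tendsto (fun r : ℝ => g (y + r • e)) (nhdsWithin 0 (Ioi 0)) (nhds (g y)) := by
    have : Continuous fun r : ℝ => g (y + r • e) := by fun_prop
    simpa using (this.tendsto 0).mono_left nhdsWithin_le_nhds
  have h2 : ∀ᶠ r : ℝ in nhdsWithin 0 (Ioi 0), y + r • e ∈ cube d X := by
    have h3 : ∀ᶠ r : ℝ in nhdsWithin 0 (Ioi 0), ∀ k, r < X - y k :=
      Filter.eventually_all.2 fun k =>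
        nhdsWithin_le_nhds (Iio_mem_nhds (sub_pos.2 (hm k).2))
    filter_upwards [h3, self_mem_nhdsWithin] with r hr hr0 k
    have h4 : (y + r • e) k = y k + r := by simp [e]
    rw [h4]
    exact ⟨add_pos_of_nonneg_of_pos (hm k).1 hr0, by linarith [hr k]⟩
  refine tendsto_nhds_unique h1 (Filter.Tendsto.congr' ?_ tendsto_const_nhds)
  filter_upwards [h2] with r hr
  exact (h0 _ hr).symm

theorem isCubePeriodic_laplacian {u : Space d → ℝ} (hu : IsCubePeriodic d X u) :
    IsCubePeriodic d X (Laplacian.laplacian u) := by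
  intro k x
  have h1 : iteratedFDeriv ℝ 2 u (x + EuclideanSpace.single k X) = iteratedFDeriv ℝ 2 u x := by
    rw [← iteratedFDeriv_comp_add_right]
    congr 1
    exact funext (hu k)
  simp only [InnerProductSpace.laplacian_eq_iteratedFDeriv_stdOrthonormalBasis, h1]

end Periodic

/-! ### Taylor expansion of second differences -/

section Taylor

variable {d : ℕ}

theorem laplacian_eq_sum_bilin (v : Space d → ℝ) (x : Space d) :
    Laplacian.laplacian v x = ∑ i, bilinearIteratedFDerivTwo ℝ v x
      (EuclideanSpace.single i 1) (EuclideanSpace.single i 1) := by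
  rw [InnerProductSpace.laplacian_eq_iteratedFDeriv_orthonormalBasis v
    (EuclideanSpace.basisFun (Fin d) ℝ)]
  simp [bilinearIteratedFDerivTwo_eq_iteratedFDeriv]

theorem iteratedFDeriv_apply_neg (v : Space d → ℝ) (x s : Space d) (k : ℕ) :
    iteratedFDeriv ℝ k v x (fun _ => -s) = (-1) ^ k * iteratedFDeriv ℝ k v x (fun _ => s) := by
  have := (iteratedFDeriv ℝ k v x).map_smul_univ (fun _ => (-1 : ℝ)) (fun _ => s)
  simpa using this

theorem abs_taylor_integral_le {v : Space d → ℝ} {M : ℝ}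
    (hM : ∀ x, ‖iteratedFDeriv ℝ 4 v x‖ ≤ M) (x s : Space d) :
    |∫ t in (0 : ℝ)..1, (1 - t) ^ 3 • iteratedFDeriv ℝ (3 + 1) v (x + t • s) (fun _ => s)|
      ≤ M * ‖s‖ ^ 4 := by
  have h := intervalIntegral.norm_integral_le_of_norm_le_const (a := 0) (b := 1)
    (C := M * ‖s‖ ^ 4)
    (f := fun t : ℝ => (1 - t) ^ 3 • iteratedFDeriv ℝ (3 + 1) v (x + t • s) (fun _ => s)) ?_
  · simpa using h
  · intro t ht
    rw [uIoc_of_le zero_le_one] at ht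
    rw [norm_smul, norm_pow, Real.norm_of_nonneg (by linarith [ht.2])]
    have h1 : (1 - t) ^ 3 ≤ 1 := pow_le_one₀ (by linarith [ht.2]) (by linarith [ht.1])
    have h2 : ‖iteratedFDeriv ℝ (3 + 1) v (x + t • s) (fun _ => s)‖ ≤ M * ‖s‖ ^ 4 := by
      refine ((iteratedFDeriv ℝ (3 + 1) v (x + t • s)).le_opNorm _).trans ?_
      simp only [Finset.prod_const, Finset.card_univ, Fintype.card_fin]
      gcongr
      exact hM _
    calc _ ≤ 1 * ‖iteratedFDeriv ℝ (3 + 1) v (x + t • s) (fun _ => s)‖ := by gcongr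
      _ ≤ _ := by rw [one_mul]; exact h2

/-- A symmetric second difference agrees with the second derivative up to fourth order. -/
theorem abs_secondDifference_sub_le {v : Space d → ℝ} (hv : ContDiff ℝ 4 v) {M : ℝ}
    (hM : ∀ x, ‖iteratedFDeriv ℝ 4 v x‖ ≤ M) (x s : Space d) :
    |v (x + s) + v (x - s) - 2 * v x - bilinearIteratedFDerivTwo ℝ v x s s|
      ≤ M / 3 * ‖s‖ ^ 4 := by
  have h1 := map_add_eq_sum_add_integral_iteratedFDeriv (n := 3) (f := v) (x := x) (y := s)
    fun t _ => (hv.of_le (by norm_num)).contDiffAt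
  have h2 := map_add_eq_sum_add_integral_iteratedFDeriv (n := 3) (f := v) (x := x) (y := -s)
    fun t _ => (hv.of_le (by norm_num)).contDiffAt
  have i1 := abs_taylor_integral_le hM x s
  have i2 := abs_taylor_integral_le hM x (-s)
  rw [norm_neg] at i2
  generalize (∫ t in (0 : ℝ)..1, (1 - t) ^ 3 •
    iteratedFDeriv ℝ (3 + 1) v (x + t • s) (fun _ => s)) = I₁ at h1 i1
  generalize (∫ t in (0 : ℝ)..1, (1 - t) ^ 3 •
    iteratedFDeriv ℝ (3 + 1) v (x + t • -s) (fun _ => -s)) = I₂ at h2 i2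
  have hB : bilinearIteratedFDerivTwo ℝ v x s s
      = iteratedFDeriv ℝ 2 v x (fun _ => s) := by
    rw [bilinearIteratedFDerivTwo_eq_iteratedFDeriv]
    congr 1
    funext i
    fin_cases i <;> rfl
  rw [← sub_eq_add_neg] at h2
  -- Odd-order terms cancel between s and -s. Two remainders, each with factor 1/3!, give the
  -- constant M/3.
  simp only [Finset.sum_range_succ, Finset.sum_range_zero, iteratedFDeriv_apply_neg] at h1 h2
  norm_num [Nat.factorial] at h1 h2
  rw [hB, h1, h2]
  rw [abs_le] at i1 i2 ⊢
  constructor <;> linarith [i1.1, i1.2, i2.1, i2.2]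

/-- At a maximum every second difference is nonpositive, so r² B(s,s) ≤ (M/3) r⁴ along each axis;
divide by r² and let r → 0. -/
theorem laplacian_nonpos_of_isMax {v : Space d → ℝ} (hv : ContDiff ℝ 4 v) {M : ℝ}
    (hM : ∀ x, ‖iteratedFDeriv ℝ 4 v x‖ ≤ M) {x : Space d} (hx : ∀ y, v y ≤ v x) :
    Laplacian.laplacian v x ≤ 0 := by
  rw [laplacian_eq_sum_bilin]
  refine Finset.sum_nonpos fun i _ => ?_
  set s : Space d := EuclideanSpace.single i 1
  set B := bilinearIteratedFDerivTwo ℝ v x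
  have h1 : ∀ r > 0, B s s ≤ M / 3 * r ^ 2 := by
    intro r hr
    have h2 := (abs_le.1 (abs_secondDifference_sub_le hv hM x (r • s))).1
    have h3 : ‖r • s‖ = r := by simp [s, norm_smul, abs_of_pos hr]
    have h4 : B (r • s) (r • s) = r ^ 2 * B s s := by simp; ring
    rw [h3, h4] at h2
    have h5 : r ^ 2 * B s s ≤ r ^ 2 * (M / 3 * r ^ 2) := by
      nlinarith [hx (x + r • s), hx (x - r • s)]
    exact le_of_mul_le_mul_left h5 (by positivity)
  have h2 : Filter.Tendsto (fun r : ℝ => M / 3 * r ^ 2) (nhdsWithin 0 (Ioi 0)) (nhds 0) := by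
    have : Continuous fun r : ℝ => M / 3 * r ^ 2 := by fun_prop
    simpa using (this.tendsto 0).mono_left nhdsWithin_le_nhds
  refine ge_of_tendsto h2 ?_
  filter_upwards [self_mem_nhdsWithin] with r hr using h1 r hr

end Taylor

/-! ### Consistency and stability of the discrete operator -/

section Consistency

variable {d N : ℕ} {δ h : ℝ} {ρ : ℝ → ℝ}

theorem gridRestrict_add_node [NeZero N] {X : ℝ} {u : Space d → ℝ} (hu : IsCubePeriodic d X u)
    (i : Fin d → ZMod N) (j : Fin d → ℤ) :
    gridRestrict N (X / N) u (i + fun k => (j k : ZMod N))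
      = u (node (X / N) (fun k => ((i k).val : ℤ)) + node (X / N) j) := by
  -- Wrap-around modulo N shifts a node by an integer multiple of N · (X/N) = X, which periodicity
  -- removes.
  have h1 : ∀ k, ∃ m : ℤ, (((i k + (j k : ZMod N)).val : ℤ)) = (i k).val + j k + N * m := by
    intro k
    have h2 : ((((i k + (j k : ZMod N)).val : ℤ)) : ZMod N) = (((i k).val + j k : ℤ) : ZMod N) := by
      push_cast
      simp
    obtain ⟨m, hm⟩ := (ZMod.intCast_eq_intCast_iff_dvd_sub _ _ N).1 h2.symm
    exact ⟨m, by linarith⟩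
  choose m hm using h1
  rw [← hu.add_node _ m, gridRestrict]
  congr 1
  ext k
  have hN : (N : ℝ) ≠ 0 := by exact_mod_cast NeZero.ne N
  simp only [PiLp.add_apply, node_apply, Pi.add_apply, hm]
  push_cast
  field_simp

theorem gridRestrict_sub_node [NeZero N] {X : ℝ} {u : Space d → ℝ} (hu : IsCubePeriodic d X u)
    (i : Fin d → ZMod N) (j : Fin d → ℤ) :
    gridRestrict N (X / N) u (i - fun k => (j k : ZMod N))
      = u (node (X / N) (fun k => ((i k).val : ℤ)) - node (X / N) j) := by
  have h1 := gridRestrict_add_node hu i (-j)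
  have h2 : node (X / N) (-j) = -node (X / N) j := by ext k; simp [node_apply]
  have h3 : (fun k => (((-j) k : ℤ) : ZMod N)) = -fun k => (j k : ZMod N) := by
    funext k; simp
  rwa [h2, h3, ← sub_eq_add_neg, ← sub_eq_add_neg] at h1

/-- Consistency of `𝓛_{δ,h}` with the local Laplacian. -/
theorem abs_discreteOp_sub_laplacian_le [NeZero N] {X : ℝ} (hX : 0 < X) (hρ : IsKernel d δ ρ)
    {u : Space d → ℝ} (hu : ContDiff ℝ 4 u) (hper : IsCubePeriodic d X u) {M : ℝ}
    (hM : ∀ x, ‖iteratedFDeriv ℝ 4 u x‖ ≤ M) (i : Fin d → ZMod N) :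
    |discreteOp δ (X / N) ρ (gridRestrict N (X / N) u) i
        - Laplacian.laplacian u (node (X / N) fun k => ((i k).val : ℤ))|
      ≤ M / 3 * (2 * δ ^ 2 + 2 * d * (X / N) ^ 2) * d := by
  have hN : (0 : ℝ) < N := by exact_mod_cast NeZero.pos N
  have hh : 0 < X / N := by positivity
  set h := X / N with hdef
  set x : Space d := node h fun k => ((i k).val : ℤ) with hx
  have hM0 : 0 ≤ M := (norm_nonneg _).trans (hM 0)
  -- Exactness on quadratic forms writes the Laplacian as a sum over the same stencil, so the
  -- difference consists of Taylor remainders only.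
  rw [discreteOp_eq, laplacian_eq_sum_bilin, ← sum_weight_mul_bilin hh hρ,
    ← Finset.sum_sub_distrib]
  calc _ ≤ ∑ j ∈ stencil d δ h,
        M / 3 * (2 * δ ^ 2 + 2 * d * h ^ 2) * (norm1 (node h j) * beta δ h ρ j) := by
        refine (Finset.abs_sum_le_sum_abs _ _).trans (Finset.sum_le_sum fun j hj => ?_)
        rw [← mul_sub, abs_mul, abs_of_nonneg (weight_nonneg hρ h j), hdef,
          gridRestrict_add_node hper, gridRestrict_sub_node hper, ← hdef, ← hx]
        have h1 : gridRestrict N h u i = u x := rfl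
        rw [h1]
        by_cases hb : beta δ h ρ j = 0
        · simp [weight, hb]
        have h2 := norm_node_sq_le_of_beta_ne_zero hh hb
        have h3 := abs_secondDifference_sub_le hu hM x (node h j)
        rw [← weight_mul_norm_sq hh (Finset.mem_erase.1 hj).1]
        have hw := weight_nonneg hρ h j
        calc _ ≤ weight δ h ρ j * (M / 3 * ‖node h j‖ ^ 4) := by gcongr
          _ = M / 3 * ‖node h j‖ ^ 2 * (weight δ h ρ j * ‖node h j‖ ^ 2) := by ring
          _ ≤ _ := by gcongr
    _ = _ := by rw [← Finset.mul_sum, sum_norm1_mul_beta hh hρ]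

theorem stabOp_mulVec [NeZero N] (ε κ : ℝ) (w : Grid d N) :
    stabOp N ε κ δ h ρ *ᵥ w = κ • w - ε ^ 2 • discreteOp δ h ρ w := by
  rw [stabOp, Matrix.add_mulVec, Matrix.smul_mulVec, Matrix.smul_mulVec, stiffness_mulVec,
    Matrix.one_mulVec, neg_smul]
  abel

theorem norm_exp_neg_smul_stabOp_mulVec_le [NeZero N] (hρ : IsKernel d δ ρ) (ε κ : ℝ)
    (s : ℝ) (hs : 0 ≤ s) (v : Grid d N) :
    ‖NormedSpace.exp (-s • stabOp N ε κ δ h ρ) *ᵥ v‖ ≤ Real.exp (-κ * s) * ‖v‖ := by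
  -- With this μ the diagonal part of L cancels: μ - L is ε² times a sum of shifts with nonnegative
  -- weights, whose row sums equal μ - κ.
  refine norm_exp_neg_smul_mulVec_le
    (μ := κ + ε ^ 2 * ∑ j ∈ stencil d δ h, 2 * weight δ h ρ j) (fun w => ?_) hs v
  have hS : 0 ≤ ∑ j ∈ stencil d δ h, 2 * weight δ h ρ j :=
    Finset.sum_nonneg fun j _ => by linarith [weight_nonneg hρ h j]
  refine (pi_norm_le_iff_of_nonneg (by rw [add_sub_cancel_left]; positivity)).2 fun i => ?_
  have h1 : ((κ + ε ^ 2 * ∑ j ∈ stencil d δ h, 2 * weight δ h ρ j) • w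
      - stabOp N ε κ δ h ρ *ᵥ w) i = ε ^ 2 * ∑ j ∈ stencil d δ h, weight δ h ρ j *
        (w (i + fun k => (j k : ZMod N)) + w (i - fun k => (j k : ZMod N))) := by
    simp only [stabOp_mulVec, Pi.sub_apply, Pi.smul_apply, smul_eq_mul, discreteOp_eq]
    have h2 : ∑ j ∈ stencil d δ h, weight δ h ρ j *
        (w (i + fun k => (j k : ZMod N)) + w (i - fun k => (j k : ZMod N)) - 2 * w i)
        = ∑ j ∈ stencil d δ h, weight δ h ρ j *
        (w (i + fun k => (j k : ZMod N)) + w (i - fun k => (j k : ZMod N)))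
        - (∑ j ∈ stencil d δ h, 2 * weight δ h ρ j) * w i := by
      rw [Finset.sum_mul, ← Finset.sum_sub_distrib]
      exact Finset.sum_congr rfl fun j _ => by ring
    rw [h2]
    ring
  rw [h1, add_sub_cancel_left, norm_mul, norm_pow, Real.norm_eq_abs, sq_abs, mul_assoc,
    Finset.sum_mul]
  refine mul_le_mul_of_nonneg_left ((norm_sum_le _ _).trans (Finset.sum_le_sum fun j _ => ?_))
    (sq_nonneg _)
  rw [norm_mul, Real.norm_of_nonneg (weight_nonneg hρ h j)]
  have h3 : ‖w (i + fun k => (j k : ZMod N)) + w (i - fun k => (j k : ZMod N))‖ ≤ 2 * ‖w‖ := by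
    refine (norm_add_le _ _).trans ?_
    linarith [norm_le_pi_norm w (i + fun k => (j k : ZMod N)),
      norm_le_pi_norm w (i - fun k => (j k : ZMod N))]
  nlinarith [weight_nonneg hρ h j]

end Consistency

/-! ### Pointwise functionals on the space of periodic C⁴ functions -/

theorem PerC4.continuous_laplacian {d : ℕ} {X : ℝ} (u : PerC4 d X) :
    Continuous (Laplacian.laplacian (⇑u : Space d → ℝ)) := by
  rw [InnerProductSpace.laplacian_eq_iteratedFDeriv_orthonormalBasis _
    (EuclideanSpace.basisFun (Fin d) ℝ)]
  have h1 : Continuous (iteratedFDeriv ℝ 2 (⇑u : Space d → ℝ)) :=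
    u.2.1.continuous_iteratedFDeriv (by norm_num)
  fun_prop

section Evaluation

variable {d : ℕ} {X : ℝ} [hX : Fact (0 < X)]

theorem PerC4.norm_iteratedFDeriv_le (u : PerC4 d X) (m : Fin 5) (x : Space d) :
    ‖iteratedFDeriv ℝ m (⇑u : Space d → ℝ) x‖ ≤ ‖u‖ := by
  rw [PerC4.norm_def]
  exact le_ciSup (PerC4.bddAbove hX.out u) (m, x)

theorem PerC4.abs_apply_le (u : PerC4 d X) (x : Space d) : |u x| ≤ ‖u‖ := by
  simpa using u.norm_iteratedFDeriv_le 0 x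

theorem PerC4.norm_laplacian_le (u : PerC4 d X) (x : Space d) :
    ‖Laplacian.laplacian (⇑u : Space d → ℝ) x‖ ≤ d * ‖u‖ := by
  rw [InnerProductSpace.laplacian_eq_iteratedFDeriv_orthonormalBasis _
    (EuclideanSpace.basisFun (Fin d) ℝ)]
  refine (norm_sum_le _ _).trans ((Finset.sum_le_sum (g := fun _ => ‖u‖) fun i _ => ?_).trans ?_)
  · refine ((iteratedFDeriv ℝ 2 (⇑u : Space d → ℝ) x).le_opNorm _).trans ?_
    simpa [Fin.prod_univ_two] using u.norm_iteratedFDeriv_le 2 x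
  · simp

/-- Evaluation at a point as a continuous linear functional on `C⁴_per`. -/
noncomputable def evalCLM (x : Space d) : PerC4 d X →L[ℝ] ℝ :=
  LinearMap.mkContinuous
    { toFun := fun u => u x, map_add' := fun _ _ => rfl, map_smul' := fun _ _ => rfl } 1
    fun u => by rw [one_mul]; exact u.abs_apply_le x

/-- The Laplacian at a point as a continuous linear functional on `C⁴_per`. -/
noncomputable def laplacianCLM (x : Space d) : PerC4 d X →L[ℝ] ℝ :=
  LinearMap.mkContinuous
    { toFun := fun u => Laplacian.laplacian (⇑u : Space d → ℝ) x
      map_add' := fun u v => ContDiffAt.laplacian_add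
        (u.2.1.of_le (by norm_num)).contDiffAt (v.2.1.of_le (by norm_num)).contDiffAt
      map_smul' := fun c u => InnerProductSpace.laplacian_smul c
        (u.2.1.of_le (by norm_num)).contDiffAt } d
    fun u => u.norm_laplacian_le x

theorem laplacianCLM_apply (x : Space d) (u : PerC4 d X) :
    laplacianCLM x u = Laplacian.laplacian (⇑u : Space d → ℝ) x := rfl

theorem continuous_apply_prod : Continuous fun p : PerC4 d X × Space d => p.1 p.2 := by
  refine continuous_prod_of_continuous_lipschitzWith _ 1 (fun u => u.2.1.continuous) fun x => ?_
  refine LipschitzWith.of_dist_le_mul fun u v => ?_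
  rw [dist_eq_norm, dist_eq_norm, NNReal.coe_one, one_mul]
  exact (u - v).abs_apply_le x

end Evaluation

/-! ### Maximum principle for the local equation -/

section MaximumPrinciple

variable {d : ℕ} {X : ℝ} [hX : Fact (0 < X)]

/-- Periodicity and spatial continuity remove the restriction to the open cube; continuity in time
adds the end points, which the maximum principle needs because the maximum may be attained at T. -/
theorem IsLocalACSolution.equation_closed {ε T : ℝ} (hT : 0 < T) {φ₀ : PerC4 d X}
    {φ φ' : ℝ → PerC4 d X} (hsol : IsLocalACSolution ε T φ₀ φ)
    (hd : ∀ t ∈ Icc 0 T, HasDerivWithinAt φ (φ' t) (Icc 0 T) t)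
    (hc : ContinuousOn φ' (Icc 0 T)) {t : ℝ} (ht : t ∈ Icc 0 T) (x : Space d) :
    φ' t x = ε ^ 2 * Laplacian.laplacian (⇑(φ t) : Space d → ℝ) x - φ t x ^ 3 + φ t x := by
  have hcφ : ContinuousOn φ (Icc 0 T) := fun t ht => (hd t ht).continuousWithinAt
  have h1 : ∀ t ∈ Ioo 0 T, ∀ x, φ' t x
      - (ε ^ 2 * Laplacian.laplacian (⇑(φ t) : Space d → ℝ) x - φ t x ^ 3 + φ t x) = 0 := by
    intro t ht
    refine IsCubePeriodic.eq_zero hX.out (fun k y => ?_) ?_ fun y hy => ?_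
    · rw [(φ' t).2.2 k y, (φ t).2.2 k y, isCubePeriodic_laplacian (φ t).2.2 k y]
    · have := (φ' t).2.1.continuous
      have := (φ t).2.1.continuous
      have := (φ t).continuous_laplacian
      fun_prop
    · have h2 := (hsol.equation t ht y hy).2
      have h3 : HasDerivAt (fun s => φ s y) (φ' t y) t :=
        (evalCLM y).hasFDerivAt.comp_hasDerivAt t
          ((hd t (Ioo_subset_Icc_self ht)).hasDerivAt (Icc_mem_nhds ht.1 ht.2))
      rw [h3.deriv] at h2
      linarith
  have h2 : EqOn (fun t => evalCLM x (φ' t))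
      (fun t => ε ^ 2 * laplacianCLM x (φ t) - evalCLM x (φ t) ^ 3 + evalCLM x (φ t)) (Icc 0 T) := by
    refine EqOn.of_subset_closure (s := Ioo 0 T) (fun t ht => sub_eq_zero.1 (h1 t ht x)) ?_ ?_
      Ioo_subset_Icc_self (closure_Ioo hT.ne).ge
    · fun_prop
    · fun_prop
  exact h2 ht

/-- The maximum principle for the local Allen–Cahn equation. -/
theorem le_one_of_allenCahn {ε T : ℝ} {φ φ' : ℝ → PerC4 d X}
    (hd : ∀ t ∈ Icc 0 T, HasDerivWithinAt φ (φ' t) (Icc 0 T) t)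
    (heq : ∀ t ∈ Icc 0 T, ∀ x, φ' t x
      = ε ^ 2 * Laplacian.laplacian (⇑(φ t) : Space d → ℝ) x - φ t x ^ 3 + φ t x)
    (h0 : ∀ x, φ 0 x ≤ 1) {t : ℝ} (ht : t ∈ Icc 0 T) (x : Space d) : φ t x ≤ 1 := by
  have hcφ : ContinuousOn φ (Icc 0 T) := fun t ht => (hd t ht).continuousWithinAt
  set K : Set (Space d) := (WithLp.toLp 2 : (Fin d → ℝ) → Space d) '' Icc 0 (fun _ => X)
  have hK : IsCompact K := isCompact_Icc.image (PiLp.continuous_toLp 2 _)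
  have hred : ∀ x : Space d, ∃ y ∈ K, ∀ s, φ s x = φ s y := by
    intro x
    obtain ⟨m, hm⟩ := exists_add_node_mem hX.out x
    exact ⟨x + node X m, ⟨WithLp.ofLp (x + node X m),
      ⟨fun k => (hm k).1, fun k => (hm k).2.le⟩, rfl⟩,
      fun s => (IsCubePeriodic.add_node (φ s).2.2 x m).symm⟩
  have hcont : ContinuousOn (fun p : ℝ × Space d => φ p.1 p.2) (Icc 0 T ×ˢ K) :=
    continuous_apply_prod.comp_continuousOn
      ((hcφ.comp continuousOn_fst fun p hp => hp.1).prodMk continuousOn_snd)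
  obtain ⟨y, hyK, hy⟩ := hred x
  obtain ⟨⟨t₀, x₀⟩, ⟨ht₀, -⟩, hmax⟩ := (isCompact_Icc.prod hK).exists_isMaxOn
    ⟨(t, y), ht, hyK⟩ hcont
  have hmax' : ∀ s ∈ Icc 0 T, ∀ z, φ s z ≤ φ t₀ x₀ := by
    intro s hs z
    obtain ⟨z', hz', hzz⟩ := hred z
    rw [hzz s]
    exact hmax (show (s, z') ∈ Icc 0 T ×ˢ K from ⟨hs, hz'⟩)
  refine (hmax' t ht x).trans ?_
  simp only at ht₀
  by_contra! hgt
  have ht₀pos : 0 < t₀ := by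
    refine ht₀.1.lt_of_ne fun h => ?_
    rw [← h] at hgt
    exact absurd (h0 x₀) (not_le.2 hgt)
  have hlap : Laplacian.laplacian (⇑(φ t₀) : Space d → ℝ) x₀ ≤ 0 :=
    laplacian_nonpos_of_isMax (φ t₀).2.1 ((φ t₀).norm_iteratedFDeriv_le 4) (hmax' t₀ ht₀)
  have hder : HasDerivWithinAt (fun s => φ s x₀) (φ' t₀ x₀) (Icc 0 T) t₀ :=
    (evalCLM x₀).hasFDerivAt.comp_hasDerivWithinAt t₀ (hd t₀ ht₀)
  have hlm : IsLocalMaxOn (fun s => φ s x₀) (Icc 0 T) t₀ :=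
    IsMaxOn.localize fun s hs => hmax' s hs x₀
  -- Since t₀ may equal T, only the backward direction is used; it already yields φ' ≥ 0 at the
  -- maximum.
  have hy : (0 : ℝ) - t₀ ∈ posTangentConeAt (Icc 0 T) t₀ :=
    sub_mem_posTangentConeAt_of_segment_subset
      ((convex_Icc 0 T).segment_subset ht₀ ⟨le_rfl, ht₀.1.trans ht₀.2⟩)
  have hnn := hlm.hasFDerivWithinAt_nonpos hder.hasFDerivWithinAt hy
  have h1 : -(t₀ * φ' t₀ x₀) ≤ 0 := by simpa using hnn
  have h2 : 0 ≤ φ' t₀ x₀ := by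
    by_contra! hneg
    nlinarith
  rw [heq t₀ ht₀ x₀] at h2
  have h3 : ε ^ 2 * Laplacian.laplacian (⇑(φ t₀) : Space d → ℝ) x₀ ≤ 0 :=
    mul_nonpos_of_nonneg_of_nonpos (sq_nonneg _) hlap
  -- This is φ³ - φ > 0 for φ > 1. With Δφ ≤ 0 the equation would force φ' < 0.
  have h4 : 0 < φ t₀ x₀ * (φ t₀ x₀ - 1) * (φ t₀ x₀ + 1) :=
    mul_pos (mul_pos (by linarith) (by linarith)) (by linarith)
  nlinarith

theorem abs_le_one_of_allenCahn {ε T : ℝ} {φ φ' : ℝ → PerC4 d X}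
    (hd : ∀ t ∈ Icc 0 T, HasDerivWithinAt φ (φ' t) (Icc 0 T) t)
    (heq : ∀ t ∈ Icc 0 T, ∀ x, φ' t x
      = ε ^ 2 * Laplacian.laplacian (⇑(φ t) : Space d → ℝ) x - φ t x ^ 3 + φ t x)
    (h0 : ∀ x, |φ 0 x| ≤ 1) {t : ℝ} (ht : t ∈ Icc 0 T) (x : Space d) : |φ t x| ≤ 1 := by
  have h1 := le_one_of_allenCahn hd heq (fun x => (abs_le.1 (h0 x)).2) ht x
  have h2 := le_one_of_allenCahn (φ := fun t => -φ t) (φ' := fun t => -φ' t) (ε := ε)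
    (fun t ht => (hd t ht).fun_neg) (fun t ht x => ?_) (fun x => ?_) ht x
  · have h3 : -(φ t x) ≤ 1 := h2
    exact abs_le.2 ⟨by linarith, h1⟩
  · have h3 : laplacianCLM x (-φ t) = -laplacianCLM x (φ t) := map_neg _ _
    rw [laplacianCLM_apply, laplacianCLM_apply] at h3
    rw [h3]
    have h4 := heq t ht x
    have e1 : (-φ' t) x = -(φ' t x) := rfl
    have e2 : (-φ t) x = -(φ t x) := rfl
    rw [e1, e2, h4]
    ring
  · have e2 : (-φ 0) x = -(φ 0 x) := rfl
    rw [e2]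
    linarith [(abs_le.1 (h0 x)).1]

end MaximumPrinciple

/-! ### Bounds for the stabilized reaction term -/

section Reaction

variable {d N : ℕ} {κ : ℝ}

theorem abs_cubic_sub_le (hκ : 2 ≤ κ) {a b : ℝ} (ha : |a| ≤ 1) (hb : |b| ≤ 1) :
    |((κ + 1) * a - a ^ 3) - ((κ + 1) * b - b ^ 3)| ≤ (κ + 1) * |a - b| := by
  have h1 : ((κ + 1) * a - a ^ 3) - ((κ + 1) * b - b ^ 3)
      = (κ + 1 - (a ^ 2 + a * b + b ^ 2)) * (a - b) := by ring
  rw [h1, abs_mul]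
  refine mul_le_mul_of_nonneg_right ?_ (abs_nonneg _)
  have ha2 : a ^ 2 ≤ 1 := (sq_le_one_iff_abs_le_one a).2 ha
  have hb2 : b ^ 2 ≤ 1 := (sq_le_one_iff_abs_le_one b).2 hb
  rw [abs_le]
  constructor <;> nlinarith [sq_nonneg (a + b), sq_nonneg (a - b)]

/-- The gap to the bound factors as κ - f(a) = (1 - a)(κ - a - a²), and symmetrically at -κ. The
second factor is nonnegative on [-1,1] because κ ≥ 2. -/
theorem abs_cubic_le (hκ : 2 ≤ κ) {a : ℝ} (ha : |a| ≤ 1) : |(κ + 1) * a - a ^ 3| ≤ κ := by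
  have ha2 : a ^ 2 ≤ 1 := (sq_le_one_iff_abs_le_one a).2 ha
  obtain ⟨h1, h2⟩ := abs_le.1 ha
  rw [abs_le]
  constructor
  · nlinarith [mul_nonneg (by linarith : 0 ≤ a + 1) (by nlinarith : 0 ≤ κ + a - a ^ 2)]
  · nlinarith [mul_nonneg (by linarith : 0 ≤ 1 - a) (by nlinarith : 0 ≤ κ - a - a ^ 2)]

theorem abs_apply_le_of_norm_le [NeZero N] {U : Grid d N} {c : ℝ} (hU : ‖U‖ ≤ c)
    (i : Fin d → ZMod N) : |U i| ≤ c :=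
  (norm_le_pi_norm U i).trans hU

theorem norm_reaction_sub_le [NeZero N] (hκ : 2 ≤ κ) {U V : Grid d N} (hU : ‖U‖ ≤ 1)
    (hV : ‖V‖ ≤ 1) : ‖reaction κ U - reaction κ V‖ ≤ (κ + 1) * ‖U - V‖ := by
  refine (pi_norm_le_iff_of_nonneg (by positivity)).2 fun i => ?_
  refine (abs_cubic_sub_le hκ (abs_apply_le_of_norm_le hU i)
    (abs_apply_le_of_norm_le hV i)).trans ?_
  exact mul_le_mul_of_nonneg_left (norm_le_pi_norm (U - V) i) (by linarith)

theorem norm_reaction_le [NeZero N] (hκ : 2 ≤ κ) {U : Grid d N} (hU : ‖U‖ ≤ 1) :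
    ‖reaction κ U‖ ≤ κ :=
  (pi_norm_le_iff_of_nonneg (by linarith)).2 fun i =>
    abs_cubic_le hκ (abs_apply_le_of_norm_le hU i)

end Reaction

/-! ### Maximum bounds and one-step error estimates -/

section OneStep

variable {d N : ℕ} [NeZero N] {κ τ : ℝ} {L : Matrix (Fin d → ZMod N) (Fin d → ZMod N) ℝ}

theorem one_sub_exp_nonneg (hκ : 2 ≤ κ) (hτ : 0 < τ) : 0 ≤ 1 - Real.exp (-κ * τ) := by
  have : Real.exp (-κ * τ) ≤ 1 := Real.exp_le_one_iff.2 (by nlinarith)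
  linarith

theorem one_sub_exp_le (κ τ : ℝ) : 1 - Real.exp (-κ * τ) ≤ κ * τ := by
  linarith [Real.add_one_le_exp (-κ * τ)]

/-- Obtained from e^x ≥ 1 + x + x²/2 and (1 - x + x²/2)(1 + x + x²/2) = 1 + x⁴/4 > 1, with x = κτ.
-/
theorem le_one_sub_exp (hκ : 2 ≤ κ) (hτ : 0 < τ) :
    κ * τ - (κ * τ) ^ 2 / 2 ≤ 1 - Real.exp (-κ * τ) := by
  have h1 := Real.quadratic_le_exp_of_nonneg (x := κ * τ) (by positivity)
  have h2 : Real.exp (-κ * τ) * Real.exp (κ * τ) = 1 := by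
    rw [← Real.exp_add]; simp
  have h3 := Real.exp_pos (-κ * τ)
  have hx : 0 < κ * τ := by positivity
  set x := κ * τ
  have h4 : Real.exp (-κ * τ) * (1 + x + x ^ 2 / 2) ≤ 1 := by nlinarith
  by_contra! hcon
  have h5 : 1 - x + x ^ 2 / 2 < Real.exp (-κ * τ) := by linarith
  have h6 : (1 - x + x ^ 2 / 2) * (1 + x + x ^ 2 / 2) < 1 :=
    (mul_lt_mul_of_pos_right h5 (by positivity)).trans_le h4
  nlinarith [pow_pos hx 4]

/-- The Duhamel bound becomes the convex combination e^{-κτ} · 1 + (1 - e^{-κτ}) · 1. -/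
theorem norm_duhamel_le_one (hκ : 2 ≤ κ) (hτ : 0 < τ)
    (hL : ∀ s, 0 ≤ s → ∀ v, ‖NormedSpace.exp (-s • L) *ᵥ v‖ ≤ Real.exp (-κ * s) * ‖v‖)
    {W : Grid d N} (hW : ‖W‖ ≤ 1) {G : ℝ → Grid d N} (hG : ∀ s ∈ Ioc 0 τ, ‖G s‖ ≤ κ) :
    ‖NormedSpace.exp (-τ • L) *ᵥ W
      + ∫ s in (0 : ℝ)..τ, NormedSpace.exp (-(τ - s) • L) *ᵥ G s‖ ≤ 1 := by
  have hκ0 : κ ≠ 0 := by linarith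
  have h := norm_duhamel_le hκ0 hτ.le hL W (p := κ) (q := 0) fun s hs => by simpa using hG s hs
  rw [div_self hκ0] at h
  nlinarith [Real.exp_pos (-κ * τ)]

/-- The maximum bound principle for ETD1. -/
theorem norm_etd1Step_le_one (hκ : 2 ≤ κ) (hτ : 0 < τ)
    (hL : ∀ s, 0 ≤ s → ∀ v, ‖NormedSpace.exp (-s • L) *ᵥ v‖ ≤ Real.exp (-κ * s) * ‖v‖)
    {W : Grid d N} (hW : ‖W‖ ≤ 1) : ‖etd1Step L κ τ W‖ ≤ 1 :=
  norm_duhamel_le_one hκ hτ hL hW fun _ _ => norm_reaction_le hκ hW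

/-- The maximum bound principle for ETDRK2. -/
theorem norm_etdrk2Step_le_one (hκ : 2 ≤ κ) (hτ : 0 < τ)
    (hL : ∀ s, 0 ≤ s → ∀ v, ‖NormedSpace.exp (-s • L) *ᵥ v‖ ≤ Real.exp (-κ * s) * ‖v‖)
    {W : Grid d N} (hW : ‖W‖ ≤ 1) : ‖etdrk2Step L κ τ W‖ ≤ 1 := by
  refine norm_duhamel_le_one hκ hτ hL hW fun s hs => ?_
  have h1 : 0 ≤ s / τ := div_nonneg hs.1.le hτ.le
  have h2 : s / τ ≤ 1 := (div_le_one hτ).2 hs.2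
  refine (norm_add_le _ _).trans ?_
  rw [norm_smul, norm_smul, Real.norm_of_nonneg h1, Real.norm_of_nonneg (by linarith)]
  have h3 := norm_reaction_le hκ hW
  have h4 := norm_reaction_le hκ (norm_etd1Step_le_one hκ hτ hL hW)
  calc _ ≤ (1 - s / τ) * κ + s / τ * κ := by gcongr
    _ = κ := by ring

variable {V V' : ℝ → Grid d N} {M R : ℝ}

/-- The error of one ETD1 step. -/
theorem norm_etd1Step_sub_le (hκ : 2 ≤ κ) (hτ : 0 < τ)
    (hL : ∀ s, 0 ≤ s → ∀ v, ‖NormedSpace.exp (-s • L) *ᵥ v‖ ≤ Real.exp (-κ * s) * ‖v‖)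
    (hV : ContinuousOn V (Icc 0 τ)) (hV' : ContinuousOn V' (Icc 0 τ))
    (hd : ∀ s ∈ Ioo 0 τ, HasDerivAt V (V' s) s) (hV1 : ∀ s ∈ Icc 0 τ, ‖V s‖ ≤ 1)
    (hlip : ∀ s ∈ Icc 0 τ, ‖V 0 - V s‖ ≤ M * s)
    (hres : ∀ s ∈ Icc 0 τ, ‖reaction κ (V s) - (V' s + L *ᵥ V s)‖ ≤ R)
    {W : Grid d N} (hW : ‖W‖ ≤ 1) :
    ‖etd1Step L κ τ W - V τ‖ ≤ (1 + τ) * ‖W - V 0‖ + τ * ((κ + 1) * (M * τ) + R) := by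
  have hκ0 : 0 < κ := by linarith
  have h0 : (0 : ℝ) ∈ Icc 0 τ := ⟨le_rfl, hτ.le⟩
  have hR : 0 ≤ R := (norm_nonneg _).trans (hres 0 h0)
  have hM : 0 ≤ M * τ := (norm_nonneg _).trans (hlip τ ⟨hτ.le, le_rfl⟩)
  have hM' : 0 ≤ M := nonneg_of_mul_nonneg_left hM hτ
  have h := norm_etd_sub_le hκ0.ne' hτ.le hL hV hV' hd (continuousOn_const (c := reaction κ W)) W
    (p := (κ + 1) * ‖W - V 0‖ + ((κ + 1) * (M * τ) + R)) (q := 0) fun s hs => ?_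
  · refine h.trans ?_
    have ha := one_sub_exp_nonneg hκ hτ
    have ha' : (1 - Real.exp (-κ * τ)) / κ ≤ τ := by
      rw [div_le_iff₀ hκ0]; linarith [one_sub_exp_le κ τ]
    set a := 1 - Real.exp (-κ * τ) with hadef
    have he : Real.exp (-κ * τ) = 1 - a := by rw [hadef]; ring
    rw [he]
    have h1 : 0 ≤ (κ + 1) * (M * τ) + R := by positivity
    -- The damping cancels κ out of the Lipschitz constant κ + 1, so the amplification is 1 + a/κ ≤
    -- 1 + τ whatever the size of κ.
    have e1 : (1 - a) * ‖W - V 0‖ + (((κ + 1) * ‖W - V 0‖ + ((κ + 1) * (M * τ) + R)) / κ * a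
        + 0 * (τ / κ - a / κ ^ 2))
        = (1 + a / κ) * ‖W - V 0‖ + a / κ * ((κ + 1) * (M * τ) + R) := by
      field_simp; ring
    rw [e1]
    gcongr
  · have h1 : reaction κ W - (V' s + L *ᵥ V s) = (reaction κ W - reaction κ (V 0))
      + (reaction κ (V 0) - reaction κ (V s)) + (reaction κ (V s) - (V' s + L *ᵥ V s)) := by abel
    rw [h1]
    refine (norm_add₃_le).trans ?_
    have h2 := norm_reaction_sub_le hκ hW (hV1 0 h0)
    have h3 := norm_reaction_sub_le hκ (hV1 0 h0) (hV1 s hs)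
    have h4 : (κ + 1) * ‖V 0 - V s‖ ≤ (κ + 1) * (M * τ) := by
      refine mul_le_mul_of_nonneg_left ((hlip s hs).trans ?_) (by linarith)
      exact mul_le_mul_of_nonneg_left hs.2 hM'
    linarith [hres s hs]

/-- The error of one ETDRK2 step. -/
theorem norm_etdrk2Step_sub_le (hκ : 2 ≤ κ) (hτ : 0 < τ)
    (hL : ∀ s, 0 ≤ s → ∀ v, ‖NormedSpace.exp (-s • L) *ᵥ v‖ ≤ Real.exp (-κ * s) * ‖v‖)
    (hV : ContinuousOn V (Icc 0 τ)) (hV' : ContinuousOn V' (Icc 0 τ))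
    (hd : ∀ s ∈ Ioo 0 τ, HasDerivAt V (V' s) s) (hV1 : ∀ s ∈ Icc 0 τ, ‖V s‖ ≤ 1)
    (hlip : ∀ s ∈ Icc 0 τ, ‖V 0 - V s‖ ≤ M * s)
    (hres : ∀ s ∈ Icc 0 τ, ‖reaction κ (V s) - (V' s + L *ᵥ V s)‖ ≤ R) {Q : ℝ}
    (hint : ∀ s ∈ Icc 0 τ, ‖(1 - s / τ) • reaction κ (V 0) + (s / τ) • reaction κ (V τ)
      - reaction κ (V s)‖ ≤ Q)
    {W : Grid d N} (hW : ‖W‖ ≤ 1) :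
    ‖etdrk2Step L κ τ W - V τ‖ ≤ (1 + τ + τ ^ 2 / 2) * ‖W - V 0‖
      + τ * ((κ + 1) * τ * ((κ + 1) * (M * τ) + R) + Q + R) := by
  have hκ0 : 0 < κ := by linarith
  have h0 : (0 : ℝ) ∈ Icc 0 τ := ⟨le_rfl, hτ.le⟩
  have hτ' : τ ∈ Icc 0 τ := ⟨hτ.le, le_rfl⟩
  have hR : 0 ≤ R := (norm_nonneg _).trans (hres 0 h0)
  have hQ : 0 ≤ Q := (norm_nonneg _).trans (hint 0 h0)
  have hM : 0 ≤ M * τ := (norm_nonneg _).trans (hlip τ hτ')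
  have hstage := norm_etd1Step_sub_le hκ hτ hL hV hV' hd hV1 hlip hres hW
  set e := ‖W - V 0‖ with he
  set E := (κ + 1) * (M * τ) + R with hE
  have hE0 : 0 ≤ E := by positivity
  have hF : Continuous fun s : ℝ => (1 - s / τ) • reaction κ W
      + (s / τ) • reaction κ (etd1Step L κ τ W) := by fun_prop
  -- The stage is weighted by s/τ, so the extra growth τe of its error enters as (κ + 1) e s.
  -- Keeping this linear term as q, instead of bounding s by τ, is what gives the sharp factor τ²/2.
  have h := norm_etd_sub_le hκ0.ne' hτ.le hL hV hV' hd hF.continuousOn W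
    (p := (κ + 1) * e + ((κ + 1) * τ * E + Q + R)) (q := (κ + 1) * e) fun s hs => ?_
  · refine h.trans ?_
    rw [← he]
    have hb := le_one_sub_exp hκ hτ
    have ha' : (1 - Real.exp (-κ * τ)) / κ ≤ τ := by
      rw [div_le_iff₀ hκ0]; linarith [one_sub_exp_le κ τ]
    set a := 1 - Real.exp (-κ * τ) with hadef
    have hexp : Real.exp (-κ * τ) = 1 - a := by rw [hadef]; ring
    rw [hexp]
    have h1 : 0 ≤ (κ + 1) * τ * E + Q + R := by positivity
    -- The amplification contains -a/κ², so a lower bound on a is needed here; it produces exactly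
    -- the quadratic Taylor polynomial of e^τ.
    have h2 : τ / κ - τ ^ 2 / 2 ≤ a / κ ^ 2 := by
      rw [le_div_iff₀ (by positivity)]
      refine le_trans (le_of_eq ?_) hb
      field_simp
    have e1 : (1 - a) * e + (((κ + 1) * e + ((κ + 1) * τ * E + Q + R)) / κ * a
        + (κ + 1) * e * (τ / κ - a / κ ^ 2))
        = (1 + τ + τ / κ - a / κ ^ 2) * e + a / κ * ((κ + 1) * τ * E + Q + R) := by
      field_simp; ring
    rw [e1]
    have he0 : 0 ≤ e := norm_nonneg _
    have h3 : 1 + τ + τ / κ - a / κ ^ 2 ≤ 1 + τ + τ ^ 2 / 2 := by linarith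
    gcongr
  · have hs1 : 0 ≤ s / τ := div_nonneg hs.1 hτ.le
    have hs2 : s / τ ≤ 1 := (div_le_one hτ).2 hs.2
    have h1 : (1 - s / τ) • reaction κ W + (s / τ) • reaction κ (etd1Step L κ τ W)
        - (V' s + L *ᵥ V s)
      = ((1 - s / τ) • (reaction κ W - reaction κ (V 0))
        + (s / τ) • (reaction κ (etd1Step L κ τ W) - reaction κ (V τ)))
        + ((1 - s / τ) • reaction κ (V 0) + (s / τ) • reaction κ (V τ) - reaction κ (V s))
        + (reaction κ (V s) - (V' s + L *ᵥ V s)) := by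
      rw [smul_sub, smul_sub]; abel
    have h2 := norm_reaction_sub_le hκ hW (hV1 0 h0)
    have h3 := (norm_reaction_sub_le hκ (norm_etd1Step_le_one hκ hτ hL hW) (hV1 τ hτ')).trans
      (mul_le_mul_of_nonneg_left hstage (by linarith))
    have h4 : ‖(1 - s / τ) • (reaction κ W - reaction κ (V 0))
        + (s / τ) • (reaction κ (etd1Step L κ τ W) - reaction κ (V τ))‖
        ≤ (1 - s / τ) * ((κ + 1) * e) + s / τ * ((κ + 1) * ((1 + τ) * e + τ * E)) := by
      refine (norm_add_le _ _).trans ?_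
      rw [norm_smul, norm_smul, Real.norm_of_nonneg hs1, Real.norm_of_nonneg (by linarith)]
      gcongr
    have h5 : (1 - s / τ) * ((κ + 1) * e) + s / τ * ((κ + 1) * ((1 + τ) * e + τ * E))
        = (κ + 1) * e + (κ + 1) * e * s + (κ + 1) * s * E := by
      field_simp; ring
    have h6 : (κ + 1) * s * E ≤ (κ + 1) * τ * E := by gcongr; exact hs.2
    rw [h1]
    refine (norm_add₃_le).trans ?_
    linarith [hint s hs, hres s hs]

end OneStep

/-! ### Linear interpolation in time and discrete Grönwall -/

section Interpolation

/-- Subtracting the tangent line at 0 changes nothing, as affine functions are interpolated exactly.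
The deviation from the tangent is at most Kτ² at s and at τ, by the mean value inequality; no second
derivative of y is needed. -/
theorem abs_linearInterpolation_sub_le {y y' : ℝ → ℝ} {τ K : ℝ} (hτ : 0 < τ)
    (hd : ∀ s ∈ Icc 0 τ, HasDerivWithinAt y (y' s) (Icc 0 τ) s)
    (hlip : ∀ s ∈ Icc 0 τ, |y' s - y' 0| ≤ K * τ) {s : ℝ} (hs : s ∈ Icc 0 τ) :
    |(1 - s / τ) * y 0 + s / τ * y τ - y s| ≤ 2 * K * τ ^ 2 := by
  have h0 : (0 : ℝ) ∈ Icc 0 τ := ⟨le_rfl, hτ.le⟩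
  have hK : 0 ≤ K * τ := (abs_nonneg _).trans (hlip 0 h0)
  have hz : ∀ s ∈ Icc 0 τ, HasDerivWithinAt (fun s => y s - s * y' 0) (y' s - y' 0) (Icc 0 τ) s :=
    fun s hs => by simpa using (hd s hs).fun_sub ((hasDerivWithinAt_id s _).mul_const (y' 0))
  have h1 : ∀ s ∈ Icc 0 τ, |y s - s * y' 0 - y 0| ≤ K * τ * s := by
    intro s hs
    have := (convex_Icc 0 τ).norm_image_sub_le_of_norm_hasDerivWithin_le hz hlip h0 hs
    simpa [Real.norm_eq_abs, abs_of_nonneg hs.1] using this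
  have h2 := h1 s hs
  have h3 := h1 τ ⟨hτ.le, le_rfl⟩
  have hs1 : 0 ≤ s / τ := div_nonneg hs.1 hτ.le
  have hs2 : s / τ ≤ 1 := (div_le_one hτ).2 hs.2
  have e1 : (1 - s / τ) * y 0 + s / τ * y τ - y s
      = s / τ * (y τ - τ * y' 0 - y 0) - (y s - s * y' 0 - y 0) := by
    field_simp; ring
  rw [e1]
  refine (abs_sub _ _).trans ?_
  rw [abs_mul, abs_of_nonneg hs1]
  have h4 : s / τ * |y τ - τ * y' 0 - y 0| ≤ 1 * (K * τ * τ) := by gcongr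
  have h5 : K * τ * s ≤ K * τ * τ := mul_le_mul_of_nonneg_left hs.2 hK
  linarith

/-- Variation of f'(v)v', the time derivative of f along the solution, when v and v' both vary by at
most Mc. -/
theorem abs_cubic_deriv_sub_le {κ M c : ℝ} (hκ : 2 ≤ κ) {v w v' w' : ℝ} (hv : |v| ≤ 1)
    (hw : |w| ≤ 1) (hw' : |w'| ≤ M) (h : |v - w| ≤ M * c) (h' : |v' - w'| ≤ M * c) :
    |((κ + 1) * v' - 3 * v ^ 2 * v') - ((κ + 1) * w' - 3 * w ^ 2 * w')|
      ≤ ((κ + 1) * M + 6 * M ^ 2) * c := by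
  have e1 : ((κ + 1) * v' - 3 * v ^ 2 * v') - ((κ + 1) * w' - 3 * w ^ 2 * w')
      = (κ + 1 - 3 * v ^ 2) * (v' - w') - 3 * ((v + w) * ((v - w) * w')) := by ring
  have hv2 : v ^ 2 ≤ 1 := (sq_le_one_iff_abs_le_one v).2 hv
  have h1 : |κ + 1 - 3 * v ^ 2| ≤ κ + 1 := abs_le.2 ⟨by linarith, by nlinarith [sq_nonneg v]⟩
  have h2 : |v + w| ≤ 2 := (abs_add_le _ _).trans (by linarith)
  have h0 : 0 ≤ M * c := (abs_nonneg _).trans h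
  rw [e1]
  refine (abs_sub _ _).trans ?_
  rw [abs_mul, abs_mul, abs_mul, abs_mul, abs_of_pos (by norm_num : (0 : ℝ) < 3)]
  calc _ ≤ (κ + 1) * (M * c) + 3 * (2 * (M * c * M)) := by gcongr
    _ = _ := by ring

theorem le_exp_mul_of_step {e : ℕ → ℝ} {τ B : ℝ} {K : ℕ} (hB : 0 ≤ B) (h0 : e 0 = 0)
    (hstep : ∀ n < K, e (n + 1) ≤ Real.exp τ * e n + τ * B) :
    ∀ n ≤ K, e n ≤ Real.exp (n * τ) * B := by
  -- The induction closes on the stronger bound with e^{nτ} - 1, because τ ≤ e^τ - 1; no factor 1/τ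
  -- or T is lost.
  have h1 : ∀ n ≤ K, e n ≤ (Real.exp (n * τ) - 1) * B := by
    intro n
    induction n with
    | zero => intro _; simp [h0]
    | succ n ih =>
      intro hn
      have h2 := ih (by omega)
      have h3 : Real.exp ((n + 1 : ℕ) * τ) = Real.exp τ * Real.exp (n * τ) := by
        rw [← Real.exp_add]; push_cast; ring_nf
      have h4 := mul_le_mul_of_nonneg_left h2 (Real.exp_pos τ).le
      have h5 := mul_nonneg (sub_nonneg.2 (Real.add_one_le_exp τ)) hB
      rw [h3]
      linarith [hstep n (by omega)]
  intro n hn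
  linarith [h1 n hn]

end Interpolation

/-! ### Grid restriction of the exact solution and global error bounds -/

section GridRestrict

variable {d N : ℕ} [NeZero N] {X : ℝ} [hX : Fact (0 < X)]

/-- Restriction to the grid as a continuous linear map on `C⁴_per`. -/
noncomputable def gridCLM (N : ℕ) [NeZero N] (h : ℝ) : PerC4 d X →L[ℝ] Grid d N :=
  ContinuousLinearMap.pi fun i => evalCLM (node h fun k => ((i k).val : ℤ))

theorem gridCLM_apply (h : ℝ) (u : PerC4 d X) : gridCLM N h u = gridRestrict N h u := rfl

theorem norm_gridCLM_le (h : ℝ) (u : PerC4 d X) : ‖gridCLM N h u‖ ≤ ‖u‖ :=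
  (pi_norm_le_iff_of_nonneg (norm_nonneg u)).2 fun _ => u.abs_apply_le _

end GridRestrict

/-- `φ` is a solution of the local Allen–Cahn equation on the closed interval `[0,T]` at all points
of space, with time derivative `φ'`, that is bounded by `1` in the maximum norm and by `M` in the
`C¹([0,T]; C⁴_per)` norm. -/
structure IsBoundedSolution {d : ℕ} {X : ℝ} [Fact (0 < X)] (ε T M : ℝ) (φ φ' : ℝ → PerC4 d X) :
    Prop where
  hasDeriv : ∀ t ∈ Icc 0 T, HasDerivWithinAt φ (φ' t) (Icc 0 T) t
  continuousOn_deriv : ContinuousOn φ' (Icc 0 T)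
  equation : ∀ t ∈ Icc 0 T, ∀ x, φ' t x
    = ε ^ 2 * Laplacian.laplacian (⇑(φ t) : Space d → ℝ) x - φ t x ^ 3 + φ t x
  abs_le_one : ∀ t ∈ Icc 0 T, ∀ x, |φ t x| ≤ 1
  norm_le : ∀ t ∈ Icc 0 T, ‖φ t‖ ≤ M
  norm_deriv_le : ∀ t ∈ Icc 0 T, ‖φ' t‖ ≤ M

section Solution

variable {d : ℕ} {X : ℝ} [hX : Fact (0 < X)] {ε κ T M : ℝ} {φ₀ : PerC4 d X}

theorem IsLocalACSolution.isBoundedSolution {φ : ℝ → PerC4 d X} (hT : 0 < T)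
    (hsol : IsLocalACSolution ε T φ₀ φ) (hmem : MemCk 1 T φ) (hM : CkNormLE 1 T φ M)
    (h0 : ∀ x, |φ₀ x| ≤ 1) : IsBoundedSolution ε T M φ (derivWithin φ (Icc 0 T)) := by
  have hd : ∀ t ∈ Icc 0 T, HasDerivWithinAt φ (derivWithin φ (Icc 0 T) t) (Icc 0 T) t :=
    fun t ht => (hmem.differentiableOn (by norm_num) t ht).hasDerivWithinAt
  have hc : ContinuousOn (derivWithin φ (Icc 0 T)) (Icc 0 T) :=
    hmem.continuousOn_derivWithin (uniqueDiffOn_Icc hT) (by norm_num)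
  have heq := fun t ht x => hsol.equation_closed hT hd hc (t := t) ht x
  refine ⟨hd, hc, heq, fun t ht x => abs_le_one_of_allenCahn hd heq ?_ ht x, fun t ht => ?_,
    fun t ht => ?_⟩
  · rw [hsol.initial]; exact h0
  · simpa using hM 0 zero_le_one t ht
  · simpa [iteratedDerivWithin_one] using hM 1 le_rfl t ht

variable {φ φ' : ℝ → PerC4 d X} (hφ : IsBoundedSolution ε T M φ φ')

section Window

variable {N : ℕ} [NeZero N] {a τ : ℝ} (ha : 0 ≤ a) (haτ : a + τ ≤ T)

include ha haτ in
theorem add_mem_Icc {s : ℝ} (hs : s ∈ Icc 0 τ) : a + s ∈ Icc 0 T :=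
  ⟨add_nonneg ha hs.1, by linarith [hs.2]⟩

include hφ ha haτ in
theorem IsBoundedSolution.hasDerivWithinAt_gridCLM (h : ℝ) {s : ℝ} (hs : s ∈ Icc 0 τ) :
    HasDerivWithinAt (fun s => gridCLM N h (φ (a + s))) (gridCLM N h (φ' (a + s))) (Icc 0 τ) s := by
  have h1 : HasDerivWithinAt (fun s => φ (a + s)) (φ' (a + s)) (Icc 0 τ) s := by
    have h2 := (hφ.hasDeriv _ (add_mem_Icc ha haτ hs)).scomp s
      ((hasDerivWithinAt_id s (Icc 0 τ)).const_add a) fun r hr => add_mem_Icc ha haτ hr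
    rw [one_smul] at h2
    exact h2
  exact (gridCLM N h).hasFDerivAt.comp_hasDerivWithinAt s h1

include hφ ha haτ in
theorem IsBoundedSolution.continuousOn_gridCLM_deriv (h : ℝ) :
    ContinuousOn (fun s => gridCLM N h (φ' (a + s))) (Icc 0 τ) :=
  (gridCLM N h).continuous.comp_continuousOn
    (hφ.continuousOn_deriv.comp (by fun_prop) fun _ hs => add_mem_Icc ha haτ hs)

include hφ in
theorem IsBoundedSolution.norm_gridCLM_le_one (h : ℝ) {t : ℝ} (ht : t ∈ Icc 0 T) :
    ‖gridCLM N h (φ t)‖ ≤ 1 :=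
  (pi_norm_le_iff_of_nonneg zero_le_one).2 fun _ => hφ.abs_le_one t ht _

include hφ ha haτ in
theorem IsBoundedSolution.norm_gridCLM_sub_le (h : ℝ) {r s : ℝ} (hr : r ∈ Icc 0 τ)
    (hs : s ∈ Icc 0 τ) :
    ‖gridCLM N h (φ (a + r)) - gridCLM N h (φ (a + s))‖ ≤ M * |r - s| :=
  (convex_Icc 0 τ).norm_image_sub_le_of_norm_hasDerivWithin_le
    (f := fun s => gridCLM N h (φ (a + s)))
    (fun _ hs => hφ.hasDerivWithinAt_gridCLM ha haτ h hs)
    (fun _ hs => (norm_gridCLM_le h _).trans (hφ.norm_deriv_le _ (add_mem_Icc ha haτ hs))) hs hr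

include hφ in
/-- The residual of the solution in the semi-discrete scheme. -/
theorem IsBoundedSolution.norm_residual_le {δ : ℝ} {ρ : ℝ → ℝ} (hρ : IsKernel d δ ρ) {t : ℝ}
    (ht : t ∈ Icc 0 T) :
    ‖reaction κ (gridCLM N (X / N) (φ t)) - (gridCLM N (X / N) (φ' t)
        + stabOp N ε κ δ (X / N) ρ *ᵥ gridCLM N (X / N) (φ t))‖
      ≤ ε ^ 2 * (M / 3 * (2 * δ ^ 2 + 2 * d * (X / N) ^ 2) * d) := by
  have hM : 0 ≤ M := (norm_nonneg _).trans (hφ.norm_le t ht)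
  refine (pi_norm_le_iff_of_nonneg (by positivity)).2 fun i => ?_
  have h1 := abs_discreteOp_sub_laplacian_le (N := N) hX.out hρ (φ t).2.1 (φ t).2.2
    (fun x => ((φ t).norm_iteratedFDeriv_le 4 x).trans (hφ.norm_le t ht)) i
  have h2 := hφ.equation t ht (node (X / N) fun k => ((i k).val : ℤ))
  have h3 : (reaction κ (gridCLM N (X / N) (φ t)) - (gridCLM N (X / N) (φ' t)
        + stabOp N ε κ δ (X / N) ρ *ᵥ gridCLM N (X / N) (φ t))) i
      = ε ^ 2 * (discreteOp δ (X / N) ρ (gridRestrict N (X / N) (φ t)) i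
        - Laplacian.laplacian (⇑(φ t) : Space d → ℝ) (node (X / N) fun k => ((i k).val : ℤ))) := by
    rw [stabOp_mulVec]
    simp only [gridCLM_apply, reaction, Pi.sub_apply, Pi.add_apply, Pi.smul_apply, smul_eq_mul]
    have e1 : gridRestrict N (X / N) (φ' t) i
      = φ' t (node (X / N) fun k => ((i k).val : ℤ)) := rfl
    have e2 : gridRestrict N (X / N) (φ t) i
      = φ t (node (X / N) fun k => ((i k).val : ℤ)) := rfl
    rw [e1, e2, h2]
    ring
  rw [h3, Real.norm_eq_abs, abs_mul, abs_of_nonneg (sq_nonneg ε)]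
  exact mul_le_mul_of_nonneg_left h1 (sq_nonneg ε)

include hφ ha haτ in
theorem IsBoundedSolution.norm_interpolation_le (hκ : 2 ≤ κ) (hτ : 0 < τ)
    (hlip : ∀ r ∈ Icc 0 T, ∀ s ∈ Icc 0 T, ‖φ' r - φ' s‖ ≤ M * |r - s|) (h : ℝ) {s : ℝ}
    (hs : s ∈ Icc 0 τ) :
    ‖(1 - s / τ) • reaction κ (gridCLM N h (φ (a + 0)))
        + (s / τ) • reaction κ (gridCLM N h (φ (a + τ))) - reaction κ (gridCLM N h (φ (a + s)))‖
      ≤ 2 * ((κ + 1) * M + 6 * M ^ 2) * τ ^ 2 := by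
  have h0 : (0 : ℝ) ∈ Icc 0 τ := ⟨le_rfl, hτ.le⟩
  have hM : 0 ≤ M := (norm_nonneg _).trans (hφ.norm_le _ (add_mem_Icc ha haτ h0))
  refine (pi_norm_le_iff_of_nonneg (by positivity)).2 fun i => ?_
  refine abs_linearInterpolation_sub_le (y := fun s => (κ + 1) * gridCLM N h (φ (a + s)) i
      - gridCLM N h (φ (a + s)) i ^ 3)
    (y' := fun s => (κ + 1) * gridCLM N h (φ' (a + s)) i
      - 3 * gridCLM N h (φ (a + s)) i ^ 2 * gridCLM N h (φ' (a + s)) i) hτ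
    (fun s hs => ?_) (fun s hs => ?_) hs
  · have h1 := hasDerivWithinAt_pi.1 (hφ.hasDerivWithinAt_gridCLM (N := N) ha haτ h hs) i
    simpa using (h1.const_mul (κ + 1)).fun_sub (h1.fun_pow 3)
  · have hb : ∀ s ∈ Icc 0 τ, |gridCLM N h (φ (a + s)) i| ≤ 1 := fun s hs =>
      hφ.abs_le_one _ (add_mem_Icc ha haτ hs) _
    have hsτ : M * |s - 0| ≤ M * τ := by
      rw [sub_zero, abs_of_nonneg hs.1]
      exact mul_le_mul_of_nonneg_left hs.2 hM
    refine abs_cubic_deriv_sub_le hκ (hb s hs) (hb 0 h0) ?_ ?_ ?_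
    · exact ((φ' (a + 0)).abs_apply_le _).trans (hφ.norm_deriv_le _ (add_mem_Icc ha haτ h0))
    · exact ((norm_le_pi_norm (gridCLM N h (φ (a + s)) - gridCLM N h (φ (a + 0))) i).trans
        (hφ.norm_gridCLM_sub_le ha haτ h hs h0)).trans hsτ
    · refine (((φ' (a + s) - φ' (a + 0)).abs_apply_le _).trans
        (hlip _ (add_mem_Icc ha haτ hs) _ (add_mem_Icc ha haτ h0))).trans ?_
      rwa [add_sub_add_left_eq_sub]

end Window

variable {N K : ℕ} [NeZero N] {δ : ℝ} {ρ : ℝ → ℝ} {U : ℕ → Grid d N}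

theorem mul_div_add_le (hT : 0 < T) {n : ℕ} (hn : n < K) :
    (n : ℝ) * (T / K) + T / K ≤ T := by
  have h1 : ((n : ℝ) + 1) ≤ K := by exact_mod_cast hn
  have h2 : (0 : ℝ) < K := by exact_mod_cast (Nat.zero_le n).trans_lt hn
  calc (n : ℝ) * (T / K) + T / K = (n + 1) * (T / K) := by ring
    _ ≤ K * (T / K) := by gcongr
    _ = T := by field_simp

include hφ in
theorem IsBoundedSolution.norm_gridRestrict_initial_le (hT : 0 < T) (h : ℝ) :
    ‖gridRestrict N h (φ 0)‖ ≤ 1 :=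
  hφ.norm_gridCLM_le_one h ⟨le_rfl, hT.le⟩

include hφ in
theorem IsBoundedSolution.norm_etd1_sub_le (hκ : 2 ≤ κ) (hT : 0 < T) (hK : 0 < K)
    (hρ : IsKernel d δ ρ) (hU : IsETD1 ε κ δ (X / N) ρ (T / K) K (φ 0) U) :
    ∀ n ≤ K, ‖U n - gridRestrict N (X / N) (φ (n * (T / K)))‖ ≤ Real.exp (n * (T / K)) *
      ((κ + 1) * (M * (T / K)) + ε ^ 2 * (M / 3 * (2 * δ ^ 2 + 2 * d * (X / N) ^ 2) * d)) := by
  have hτ : 0 < T / K := div_pos hT (by exact_mod_cast hK)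
  have hM : 0 ≤ M := (norm_nonneg _).trans (hφ.norm_le 0 ⟨le_rfl, hT.le⟩)
  have hL := norm_exp_neg_smul_stabOp_mulVec_le (N := N) (h := X / N) hρ ε κ
  have hU1 : ∀ n ≤ K, ‖U n‖ ≤ 1 := by
    intro n
    induction n with
    | zero => intro _; rw [hU.1]; exact hφ.norm_gridRestrict_initial_le hT _
    | succ n ih =>
      intro hn
      rw [hU.2 n (by omega)]
      exact norm_etd1Step_le_one hκ hτ hL (ih (by omega))
  -- The maximum bound keeps U n in the ball where f is Lipschitz, so the one-step estimate applies
  -- on each window starting at t_n.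
  refine le_exp_mul_of_step (by positivity) (by simp [hU.1]) fun n hn => ?_
  have ha : 0 ≤ (n : ℝ) * (T / K) := by positivity
  have haτ := mul_div_add_le hT hn
  have hstep := norm_etd1Step_sub_le (V := fun s => gridCLM N (X / N) (φ (n * (T / K) + s)))
    (V' := fun s => gridCLM N (X / N) (φ' (n * (T / K) + s))) (M := M) hκ hτ hL
    (fun s hs => (hφ.hasDerivWithinAt_gridCLM ha haτ _ hs).continuousWithinAt)
    (hφ.continuousOn_gridCLM_deriv ha haτ _)
    (fun s hs => (hφ.hasDerivWithinAt_gridCLM ha haτ _ (Ioo_subset_Icc_self hs)).hasDerivAt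
      (Icc_mem_nhds hs.1 hs.2))
    (fun s hs => hφ.norm_gridCLM_le_one _ (add_mem_Icc ha haτ hs))
    (fun s hs => by
      simpa [abs_of_nonneg hs.1] using hφ.norm_gridCLM_sub_le ha haτ (X / N) ⟨le_rfl, hτ.le⟩ hs)
    (fun s hs => hφ.norm_residual_le hρ (add_mem_Icc ha haτ hs)) (hU1 n hn.le)
  have e1 : ((n + 1 : ℕ) : ℝ) * (T / K) = n * (T / K) + T / K := by push_cast; ring
  rw [hU.2 n hn, e1]
  refine hstep.trans ?_
  simp only [add_zero, gridCLM_apply]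
  gcongr
  linarith [Real.add_one_le_exp (T / K)]

include hφ in
theorem IsBoundedSolution.norm_etdrk2_sub_le (hκ : 2 ≤ κ) (hT : 0 < T) (hK : 0 < K)
    (hlip : ∀ r ∈ Icc 0 T, ∀ s ∈ Icc 0 T, ‖φ' r - φ' s‖ ≤ M * |r - s|)
    (hρ : IsKernel d δ ρ) (hU : IsETDRK2 ε κ δ (X / N) ρ (T / K) K (φ 0) U) {R : ℝ}
    (hR : ε ^ 2 * (M / 3 * (2 * δ ^ 2 + 2 * d * (X / N) ^ 2) * d) = R) :
    ∀ n ≤ K, ‖U n - gridRestrict N (X / N) (φ (n * (T / K)))‖ ≤ Real.exp (n * (T / K)) *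
      ((κ + 1) * (T / K) * ((κ + 1) * (M * (T / K)) + R)
        + 2 * ((κ + 1) * M + 6 * M ^ 2) * (T / K) ^ 2 + R) := by
  have hτ : 0 < T / K := div_pos hT (by exact_mod_cast hK)
  have hM : 0 ≤ M := (norm_nonneg _).trans (hφ.norm_le 0 ⟨le_rfl, hT.le⟩)
  have hR0 : 0 ≤ R := by rw [← hR]; positivity
  have hL := norm_exp_neg_smul_stabOp_mulVec_le (N := N) (h := X / N) hρ ε κ
  have hU1 : ∀ n ≤ K, ‖U n‖ ≤ 1 := by
    intro n
    induction n with
    | zero => intro _; rw [hU.1]; exact hφ.norm_gridRestrict_initial_le hT _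
    | succ n ih =>
      intro hn
      rw [hU.2 n (by omega)]
      exact norm_etdrk2Step_le_one hκ hτ hL (ih (by omega))
  refine le_exp_mul_of_step (by positivity) (by simp [hU.1]) fun n hn => ?_
  have ha : 0 ≤ (n : ℝ) * (T / K) := by positivity
  have haτ := mul_div_add_le hT hn
  have hstep := norm_etdrk2Step_sub_le (V := fun s => gridCLM N (X / N) (φ (n * (T / K) + s)))
    (V' := fun s => gridCLM N (X / N) (φ' (n * (T / K) + s))) (M := M) hκ hτ hL
    (fun s hs => (hφ.hasDerivWithinAt_gridCLM ha haτ _ hs).continuousWithinAt)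
    (hφ.continuousOn_gridCLM_deriv ha haτ _)
    (fun s hs => (hφ.hasDerivWithinAt_gridCLM ha haτ _ (Ioo_subset_Icc_self hs)).hasDerivAt
      (Icc_mem_nhds hs.1 hs.2))
    (fun s hs => hφ.norm_gridCLM_le_one _ (add_mem_Icc ha haτ hs))
    (fun s hs => by
      simpa [abs_of_nonneg hs.1] using hφ.norm_gridCLM_sub_le ha haτ (X / N) ⟨le_rfl, hτ.le⟩ hs)
    (fun s hs => (hφ.norm_residual_le hρ (add_mem_Icc ha haτ hs)).trans_eq hR)
    (fun s hs => hφ.norm_interpolation_le ha haτ hκ hτ hlip _ hs) (hU1 n hn.le)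
  have e1 : ((n + 1 : ℕ) : ℝ) * (T / K) = n * (T / K) + T / K := by push_cast; ring
  rw [hU.2 n hn, e1]
  refine hstep.trans ?_
  simp only [add_zero, gridCLM_apply]
  gcongr
  exact Real.quadratic_le_exp_of_nonneg hτ.le

/-- The only use of the second time derivative: it makes φ' Lipschitz, as the interpolation estimate
requires. -/
theorem norm_derivWithin_sub_le {φ : ℝ → PerC4 d X} (hT : 0 < T) (hmem : MemCk 2 T φ)
    (hM : CkNormLE 2 T φ M) : ∀ r ∈ Icc 0 T, ∀ s ∈ Icc 0 T,
      ‖derivWithin φ (Icc 0 T) r - derivWithin φ (Icc 0 T) s‖ ≤ M * |r - s| := by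
  intro r hr s hs
  have hdiff : DifferentiableOn ℝ (iteratedDerivWithin 1 φ (Icc 0 T)) (Icc 0 T) :=
    hmem.differentiableOn_iteratedDerivWithin (by norm_num) (uniqueDiffOn_Icc hT)
  have h1 := (convex_Icc 0 T).norm_image_sub_le_of_norm_derivWithin_le hdiff
    (C := M) (fun t ht => by
      rw [← iteratedDerivWithin_succ]; exact hM 2 le_rfl t ht) hs hr
  simpa [iteratedDerivWithin_one] using h1

theorem exists_ckNormLE {φ : ℝ → PerC4 d X} (hT : 0 < T) {k : ℕ} (hmem : MemCk k T φ) :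
    ∃ M, CkNormLE k T φ M := by
  have h : ∀ i : ℕ, ∃ B, i ≤ k → ∀ t ∈ Icc 0 T, ‖iteratedDerivWithin i φ (Icc 0 T) t‖ ≤ B := by
    intro i
    by_cases hi : i ≤ k
    · obtain ⟨B, hB⟩ := isCompact_Icc.exists_bound_of_continuousOn
        (hmem.continuousOn_iteratedDerivWithin (by exact_mod_cast hi) (uniqueDiffOn_Icc hT))
      exact ⟨B, fun _ => hB⟩
    · exact ⟨0, fun h => absurd h hi⟩
  choose B hB using h
  refine ⟨∑ i ∈ Finset.range (k + 1), |B i|, fun i hi t ht => (hB i hi t ht).trans ?_⟩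
  exact (le_abs_self _).trans (Finset.single_le_sum (f := fun i => |B i|)
    (fun _ _ => abs_nonneg _) (Finset.mem_range.2 (by omega)))

theorem CkNormLE.mono {φ : ℝ → PerC4 d X} {k l : ℕ} (hM : CkNormLE k T φ M) (h : l ≤ k) :
    CkNormLE l T φ M := fun i hi => hM i (hi.trans h)

end Solution

/-! ### Assembly of the constants and joint convergence -/

theorem consistency_bound {d : ℕ} (hd : 0 < d) {ε M δ h : ℝ} (hM : 0 ≤ M) :
    ε ^ 2 * (M / 3 * (2 * δ ^ 2 + 2 * d * h ^ 2) * d)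
      ≤ ε ^ 2 * M * d ^ 2 * (δ ^ 2 + h ^ 2) := by
  have hd1 : (1 : ℝ) ≤ d := by exact_mod_cast hd
  have h1 : 2 * δ ^ 2 + 2 * d * h ^ 2 ≤ 3 * d * (δ ^ 2 + h ^ 2) := by
    have h2 := mul_nonneg (sub_nonneg.2 hd1) (sq_nonneg δ)
    have h3 := mul_nonneg (zero_le_one.trans hd1) (sq_nonneg h)
    nlinarith [sq_nonneg δ]
  calc ε ^ 2 * (M / 3 * (2 * δ ^ 2 + 2 * d * h ^ 2) * d)
      ≤ ε ^ 2 * (M / 3 * (3 * d * (δ ^ 2 + h ^ 2)) * d) := by gcongr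
    _ = _ := by ring

theorem etd1_error {d : ℕ} (hd : 0 < d) {ε κ : ℝ} (hκ : 2 ≤ κ) (M : ℝ) :
    ∃ C > 0, ∀ (X : ℝ) [Fact (0 < X)] (T : ℝ), 0 < T →
      ∀ (φ₀ : PerC4 d X) (φ : ℝ → PerC4 d X), IsLocalACSolution ε T φ₀ φ →
        MemCk 1 T φ → CkNormLE 1 T φ M → (∀ x, |φ₀ x| ≤ 1) →
      ∀ (δ : ℝ), 0 < δ → ∀ (ρ : ℝ → ℝ), IsKernel d δ ρ →
      ∀ (N : ℕ) [NeZero N] (K : ℕ), 0 < K → ∀ U : ℕ → Grid d N,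
        IsETD1 ε κ δ (X / N) ρ (T / K) K φ₀ U →
      ∀ n ≤ K, ‖U n - gridRestrict N (X / N) (φ (n * (T / K)))‖
        ≤ C * Real.exp (n * (T / K)) * (δ ^ 2 + (X / N) ^ 2 + T / K) := by
  -- The constant is chosen before any solution is given, so M may be negative: hence |M|, and the
  -- added 1 for strict positivity.
  refine ⟨(κ + 1) * |M| + ε ^ 2 * |M| * d ^ 2 + 1, by positivity, ?_⟩
  intro X _ T hT φ₀ φ hsol hmem hM h0 δ hδ ρ hρ N _ K hK U hU n hn
  have hφ := hsol.isBoundedSolution hT hmem hM h0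
  have hM0 : 0 ≤ M := (norm_nonneg _).trans (hφ.norm_le 0 ⟨le_rfl, hT.le⟩)
  rw [← hsol.initial] at hU
  refine (hφ.norm_etd1_sub_le hκ hT hK hρ hU n hn).trans ?_
  have h1 := consistency_bound hd (ε := ε) (δ := δ) (h := X / N) hM0
  have hτ : 0 ≤ T / K := by positivity
  have hh : 0 ≤ (X / N) ^ 2 := sq_nonneg _
  rw [abs_of_nonneg hM0, mul_comm _ (Real.exp _), mul_assoc (Real.exp _)]
  refine mul_le_mul_of_nonneg_left ?_ (Real.exp_pos _).le
  have e1 : 0 ≤ (κ + 1) * M * (δ ^ 2 + (X / N) ^ 2) := by positivity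
  have e2 : 0 ≤ ε ^ 2 * M * d ^ 2 * (T / K) := by positivity
  nlinarith [sq_nonneg δ]

theorem etdrk2_error {d : ℕ} (hd : 0 < d) {ε κ : ℝ} (hκ : 2 ≤ κ) (M : ℝ) :
    ∃ C > 0, ∀ (X : ℝ) [Fact (0 < X)] (T : ℝ), 0 < T →
      ∀ (φ₀ : PerC4 d X) (φ : ℝ → PerC4 d X), IsLocalACSolution ε T φ₀ φ →
        MemCk 2 T φ → CkNormLE 2 T φ M → (∀ x, |φ₀ x| ≤ 1) →
      ∀ (δ : ℝ), 0 < δ → ∀ (ρ : ℝ → ℝ), IsKernel d δ ρ →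
      ∀ (N : ℕ) [NeZero N] (K : ℕ), 0 < K → T / K ≤ 1 → ∀ U : ℕ → Grid d N,
        IsETDRK2 ε κ δ (X / N) ρ (T / K) K φ₀ U →
      ∀ n ≤ K, ‖U n - gridRestrict N (X / N) (φ (n * (T / K)))‖
        ≤ C * Real.exp (n * (T / K)) * (δ ^ 2 + (X / N) ^ 2 + (T / K) ^ 2) := by
  -- The first group collects the τ² terms from the stage and the interpolation. The factor κ + 2
  -- bounds (κ + 1)τ + 1 in front of the spatial residual, using τ ≤ 1.
  refine ⟨((κ + 1) ^ 2 * |M| + 2 * ((κ + 1) * |M| + 6 * |M| ^ 2))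
    + (κ + 2) * (ε ^ 2 * |M| * d ^ 2) + 1, by positivity, ?_⟩
  intro X _ T hT φ₀ φ hsol hmem hM h0 δ hδ ρ hρ N _ K hK hτ1 U hU n hn
  have hφ := hsol.isBoundedSolution hT (ContDiffOn.of_le hmem (by norm_num))
    (hM.mono one_le_two) h0
  have hM0 : 0 ≤ M := (norm_nonneg _).trans (hφ.norm_le 0 ⟨le_rfl, hT.le⟩)
  rw [← hsol.initial] at hU
  refine (hφ.norm_etdrk2_sub_le hκ hT hK (norm_derivWithin_sub_le hT hmem hM) hρ hU rfl
    n hn).trans ?_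
  have h1 := consistency_bound hd (ε := ε) (δ := δ) (h := X / N) hM0
  have hR0 : 0 ≤ ε ^ 2 * (M / 3 * (2 * δ ^ 2 + 2 * d * (X / N) ^ 2) * d) := by positivity
  set R := ε ^ 2 * (M / 3 * (2 * δ ^ 2 + 2 * d * (X / N) ^ 2) * d)
  have hτ : 0 ≤ T / K := by positivity
  set τ := T / K
  have hh : 0 ≤ (X / N) ^ 2 := sq_nonneg _
  rw [abs_of_nonneg hM0, mul_comm _ (Real.exp _), mul_assoc (Real.exp _)]
  refine mul_le_mul_of_nonneg_left ?_ (Real.exp_pos _).le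
  set P := (κ + 1) ^ 2 * M + 2 * ((κ + 1) * M + 6 * M ^ 2) with hP
  set Q := ε ^ 2 * M * d ^ 2 with hQ
  have hP0 : 0 ≤ P := by positivity
  have hQ0 : 0 ≤ Q := by positivity
  have e0 : (κ + 1) * τ * R ≤ (κ + 1) * 1 * R := by gcongr
  have e3 : (κ + 2) * R ≤ (κ + 2) * (Q * (δ ^ 2 + (X / N) ^ 2)) := by gcongr
  have e4 : (κ + 1) * τ * ((κ + 1) * (M * τ) + R)
      + 2 * ((κ + 1) * M + 6 * M ^ 2) * τ ^ 2 + R = P * τ ^ 2 + (κ + 1) * τ * R + R := by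
    rw [hP]; ring
  have e1 : 0 ≤ P * (δ ^ 2 + (X / N) ^ 2) := by positivity
  have e2 : 0 ≤ (κ + 2) * Q * τ ^ 2 := by positivity
  rw [e4]
  nlinarith [sq_nonneg δ, sq_nonneg τ]

/-- The condition r ≤ 1 lets smallness of δ, h or τ pass to their squares, and also supplies the
restriction τ ≤ 1 of the ETDRK2 estimate. -/
theorem exists_threshold {C T η : ℝ} (hC : 0 < C) (hη : 0 < η) :
    ∃ r > 0, r ≤ 1 ∧ ∀ t ≤ T, ∀ a < r, ∀ b < r, ∀ c < r,
      C * Real.exp t * (a + b + c) < η := by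
  have hE : 0 < C * Real.exp T * 3 := by positivity
  refine ⟨min 1 (η / (C * Real.exp T * 3)), by positivity, min_le_left _ _, ?_⟩
  intro t ht a ha b hb c hc
  have h1 := (min_le_right 1 (η / (C * Real.exp T * 3)))
  have hr : 0 < min 1 (η / (C * Real.exp T * 3)) := by positivity
  set r := min 1 (η / (C * Real.exp T * 3))
  have h2 : r * (C * Real.exp T * 3) ≤ η := (le_div_iff₀ hE).1 h1
  calc C * Real.exp t * (a + b + c) < C * Real.exp t * (3 * r) := by
        gcongr; linarith
    _ ≤ C * Real.exp T * (3 * r) := by gcongr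
    _ = r * (C * Real.exp T * 3) := by ring
    _ ≤ η := h2

theorem mul_div_le {T : ℝ} (hT : 0 < T) {n K : ℕ} (hK : 0 < K) (hn : n ≤ K) :
    (n : ℝ) * (T / K) ≤ T := by
  have h1 : (n : ℝ) ≤ K := by exact_mod_cast hn
  have h2 : (0 : ℝ) < K := by exact_mod_cast hK
  calc (n : ℝ) * (T / K) ≤ K * (T / K) := by gcongr
    _ = T := by field_simp

theorem sq_lt_of_lt {a r : ℝ} (ha : 0 ≤ a) (har : a < r) (hr : r ≤ 1) : a ^ 2 < r := by
  nlinarith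

end NonlocalAC

open NonlocalAC
theorem mainTheorem5 (d : ℕ) (hd : 0 < d) (ε κ : ℝ) (hε : 0 < ε) (hκ : 2 ≤ κ) :
    -- error estimate for ETD1
    (∀ M : ℝ, ∃ C > 0, ∀ (X : ℝ) [Fact (0 < X)] (T : ℝ), 0 < T →
      ∀ (φ₀ : PerC4 d X) (φ : ℝ → PerC4 d X), IsLocalACSolution ε T φ₀ φ →
        MemCk 1 T φ → CkNormLE 1 T φ M → (∀ x, |φ₀ x| ≤ 1) →
      ∀ (δ : ℝ), 0 < δ → ∀ (ρ : ℝ → ℝ), IsKernel d δ ρ →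
      ∀ (N : ℕ) [NeZero N] (K : ℕ), 0 < K → ∀ U : ℕ → Grid d N,
        IsETD1 ε κ δ (X / N) ρ (T / K) K φ₀ U →
      ∀ n ≤ K, ‖U n - gridRestrict N (X / N) (φ (n * (T / K)))‖
        ≤ C * Real.exp (n * (T / K)) * (δ ^ 2 + (X / N) ^ 2 + T / K)) ∧
    -- error estimate for ETDRK2
    (∀ M : ℝ, ∃ C > 0, ∀ (X : ℝ) [Fact (0 < X)] (T : ℝ), 0 < T →
      ∀ (φ₀ : PerC4 d X) (φ : ℝ → PerC4 d X), IsLocalACSolution ε T φ₀ φ →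
        MemCk 2 T φ → CkNormLE 2 T φ M → (∀ x, |φ₀ x| ≤ 1) →
      ∀ (δ : ℝ), 0 < δ → ∀ (ρ : ℝ → ℝ), IsKernel d δ ρ →
      ∀ (N : ℕ) [NeZero N] (K : ℕ), 0 < K → T / K ≤ 1 → ∀ U : ℕ → Grid d N,
        IsETDRK2 ε κ δ (X / N) ρ (T / K) K φ₀ U →
      ∀ n ≤ K, ‖U n - gridRestrict N (X / N) (φ (n * (T / K)))‖
        ≤ C * Real.exp (n * (T / K)) * (δ ^ 2 + (X / N) ^ 2 + (T / K) ^ 2)) ∧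
    -- joint convergence of both schemes
    (∀ (X : ℝ) [Fact (0 < X)] (T : ℝ), 0 < T →
      ∀ (φ₀ : PerC4 d X) (φ : ℝ → PerC4 d X), IsLocalACSolution ε T φ₀ φ →
        (∀ x, |φ₀ x| ≤ 1) →
      (MemCk 1 T φ → ∀ η > 0, ∃ r > 0, ∀ (δ : ℝ), 0 < δ → δ < r →
        ∀ (ρ : ℝ → ℝ), IsKernel d δ ρ →
        ∀ (N : ℕ) [NeZero N] (K : ℕ), 0 < K → X / N < r → T / K < r →
        ∀ U : ℕ → Grid d N, IsETD1 ε κ δ (X / N) ρ (T / K) K φ₀ U →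
        ∀ n ≤ K, ‖U n - gridRestrict N (X / N) (φ (n * (T / K)))‖ < η) ∧
      (MemCk 2 T φ → ∀ η > 0, ∃ r > 0, ∀ (δ : ℝ), 0 < δ → δ < r →
        ∀ (ρ : ℝ → ℝ), IsKernel d δ ρ →
        ∀ (N : ℕ) [NeZero N] (K : ℕ), 0 < K → X / N < r → T / K < r →
        ∀ U : ℕ → Grid d N, IsETDRK2 ε κ δ (X / N) ρ (T / K) K φ₀ U →
        ∀ n ≤ K, ‖U n - gridRestrict N (X / N) (φ (n * (T / K)))‖ < η)) := by
  refine ⟨etd1_error hd hκ, etdrk2_error hd hκ, ?_⟩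
  intro X hX T hT φ₀ φ hsol h0
  refine ⟨fun hmem η hη => ?_, fun hmem η hη => ?_⟩
  · obtain ⟨M, hM⟩ := exists_ckNormLE hT hmem
    obtain ⟨C, hC, hmain⟩ := etd1_error hd (ε := ε) hκ M
    obtain ⟨r, hr, hr1, hlt⟩ := exists_threshold (T := T) hC hη
    refine ⟨r, hr, fun δ hδ hδr ρ hρ N _ K hK hhr hτr U hU n hn => ?_⟩
    refine (hmain X T hT φ₀ φ hsol hmem hM h0 δ hδ ρ hρ N K hK U hU n hn).trans_lt ?_
    exact hlt _ (mul_div_le hT hK hn) _ (sq_lt_of_lt hδ.le hδr hr1) _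
      (sq_lt_of_lt (div_nonneg hX.out.le (Nat.cast_nonneg N)) hhr hr1) _ hτr
  · obtain ⟨M, hM⟩ := exists_ckNormLE hT hmem
    obtain ⟨C, hC, hmain⟩ := etdrk2_error hd (ε := ε) hκ M
    obtain ⟨r, hr, hr1, hlt⟩ := exists_threshold (T := T) hC hη
    refine ⟨r, hr, fun δ hδ hδr ρ hρ N _ K hK hhr hτr U hU n hn => ?_⟩
    refine (hmain X T hT φ₀ φ hsol hmem hM h0 δ hδ ρ hρ N K hK (hτr.le.trans hr1)
      U hU n hn).trans_lt ?_
    exact hlt _ (mul_div_le hT hK hn) _ (sq_lt_of_lt hδ.le hδr hr1) _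
      (sq_lt_of_lt (div_nonneg hX.out.le (Nat.cast_nonneg N)) hhr hr1) _
      (sq_lt_of_lt (div_nonneg hT.le (Nat.cast_nonneg K)) hτr hr1)
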